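/- Conventions. Graphs are finite and simple. The density of a graph $G=(V,E)$ is $2|E|/|V|^2$. For vertex sets $A,B$ let $d_G(A,B)=e_G(A,B)/(|A||B|)$, where $e_G(A,B)$ is the number of pairs $(u,v)\in A\times B$ with $uv\in E$. The pair $(A,B)$ is $\epsilon$-regular if $|d_G(A,B)-d_G(A',B')|\le\epsilon$ for all $A'\subseteq A$, $B'\subseteq B$ with $|A'|\ge\epsilon|A|$, $|B'|\ge\epsilon|B|$. An equipartition $\{Z_1,\dots,Z_k\}$ of $V$ (a partition into $k$ nonempty parts whose sizes differ by at most $1$) has order $k$, and is $\epsilon$-regular if all but at most $\epsilon k^2$ of the $k^2$ ordered pairs $(Z_i,Z_j)$ are $\epsilon$-regular. A graph $(V,E')$ is $\delta$-close to $(V,E)$ if $|E\,\triangle\,E'|\le\delta|E|$. For $\epsilon,\delta,p>0$ let $S(\epsilon,\delta,p)$ be the smallest integer $S$ such that for every graph $G$ of density at least $p$ and every equipartition $\mathcal P_0$ of $V(G)$ of order at most $1/\epsilon$, some graph that is $\delta$-close to $G$ has an $\epsilon$-regular equipartition that refines $\mathcal P_0$ and has order at most $S$. Let $\mathrm{twr}(x)$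 be the tower of twos of height $\lfloor x\rfloor$, that is, $\mathrm{twr}(x)=1$ for $0\le x<1$ and $\mathrm{twr}(x+1)=2^{\mathrm{twr}(x)}$ for $x\ge 0$. Logarithms are to base $2$. Theorem. There are absolute constants $\delta_0,c>0$ such that the following holds. (1) For every real $p$ with $0<p<1$, $$S(p^5,\delta_0,p)\ \ge\ \mathrm{twr}(c\log(1/p)).$$ (2) Let $p=2^{-s}$ with $s\ge 0$ an integer. Then there is an integer $N_0\ge1$ such that for every positive multiple $N$ of $N_0$, the edges of the complete bipartite graph $K_{N,N}$ can be partitioned into $1/p$ graphs $G_1,\dots,G_{1/p}$ on the vertex set of $K_{N,N}$, each having density $p$ as a bipartite graph (that is, $|E(G_i)|=pN^2$), such that each $G_i$ witnesses the bound in (1): every $p^5$-regular equipartition of every graph that is $\delta_0$-close to $G_i$ has order at least $\mathrm{twr}(c\log(1/p))$. -/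

import Mathlib

/-- Towers of twos of integer height: `1, 2, 2 ^ 2, 2 ^ 2 ^ 2, …`. -/
def towerNat : ℕ → ℕ
  | 0 => 1
  | n + 1 => 2 ^ towerNat n

/-- `twr x` is the tower of twos of height `x`; a real height is rounded down. -/
noncomputable def twr (x : ℝ) : ℕ := towerNat ⌊x⌋₊

/-- The density `2|E| / |V|²` of a finite graph. -/
noncomputable def graphDensity {V : Type} [Fintype V] (G : SimpleGraph V) : ℝ :=
  2 * (G.edgeSet.ncard : ℝ) / (Fintype.card V : ℝ) ^ 2

open Classical in
/-- The density `d_G(A, B) = e_G(A, B) / (|A| |B|)`, where `e_G(A, B)` counts the ordered pairs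
in `A × B` that are adjacent. -/
noncomputable def pairDensity {V : Type} (G : SimpleGraph V) (A B : Finset V) : ℝ :=
  (G.edgeDensity A B : ℝ)

/-- The pair `(A, B)` is `ε`-regular in `G`. -/
def IsRegularPair {V : Type} (G : SimpleGraph V) (ε : ℝ) (A B : Finset V) : Prop :=
  ∀ A' ⊆ A, ∀ B' ⊆ B, ε * (A.card : ℝ) ≤ (A'.card : ℝ) → ε * (B.card : ℝ) ≤ (B'.card : ℝ) →
    |pairDensity G A B - pairDensity G A' B'| ≤ ε

open Classical in
/-- `Z` is an `ε`-regular equipartition of the vertices of `G`: the sizes of its `k` parts differ by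
at most one, and all but at most `ε k²` of the `k²` ordered pairs of parts are `ε`-regular. -/
def IsRegularEquipartition {V : Type} [Fintype V] [DecidableEq V] (G : SimpleGraph V) (ε : ℝ)
    (Z : Finpartition (Finset.univ : Finset V)) : Prop :=
  Z.IsEquipartition ∧
    (((Z.parts ×ˢ Z.parts).filter fun AB => ¬ IsRegularPair G ε AB.1 AB.2).card : ℝ)
      ≤ ε * (Z.parts.card : ℝ) ^ 2

/-- `H` is `δ`-close to `G`: it arises from `G` by adding and/or removing at most `δ |E(G)|`
edges. -/
def IsCloseTo {V : Type} (δ : ℝ) (H G : SimpleGraph V) : Prop :=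
  ((symmDiff G.edgeSet H.edgeSet).ncard : ℝ) ≤ δ * (G.edgeSet.ncard : ℝ)

/-- The integer `S` has the property in the definition of the sparse regular approximation
lemma. -/
def IsSRALBound (ε δ p : ℝ) (S : ℕ) : Prop :=
  ∀ (V : Type) [Fintype V] [DecidableEq V] (G : SimpleGraph V), p ≤ graphDensity G →
    ∀ P₀ : Finpartition (Finset.univ : Finset V), P₀.IsEquipartition →
      (P₀.parts.card : ℝ) ≤ 1 / ε →
      ∃ H : SimpleGraph V, IsCloseTo δ H G ∧
        ∃ Z : Finpartition (Finset.univ : Finset V),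
          IsRegularEquipartition H ε Z ∧ Z ≤ P₀ ∧ Z.parts.card ≤ S

/-- The function `S(ε, δ, p)` of the sparse regular approximation lemma: the smallest integer with
the property `IsSRALBound ε δ p` (and `⊤` if there were none). -/
noncomputable def sral (ε δ p : ℝ) : ℕ∞ :=
  ⨅ (S : ℕ) (_ : IsSRALBound ε δ p S), (S : ℕ∞)

/-- Every `ε`-regular equipartition of every graph that is `δ`-close to `G` has order at least
`L`. -/
def ForcesOrder {V : Type} [Fintype V] [DecidableEq V] (G : SimpleGraph V) (ε δ : ℝ)
    (L : ℕ) : Prop :=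
  ∀ H : SimpleGraph V, IsCloseTo δ H G →
    ∀ Z : Finpartition (Finset.univ : Finset V), IsRegularEquipartition H ε Z → L ≤ Z.parts.card

/-- The edges of `K` are partitioned by the edge sets of the graphs `F i`. -/
def IsEdgeDecomposition {V ι : Type} (K : SimpleGraph V) (F : ι → SimpleGraph V) : Prop :=
  (∀ i, F i ≤ K) ∧ ∀ u v, K.Adj u v → ∃! i, (F i).Adj u v

/-- The density `|E(G)| / N²`, between its two sides, of a bipartite graph whose sides are the two
copies of `Fin N`. -/
noncomputable def bipartiteDensity {N : ℕ} (G : SimpleGraph (Fin N ⊕ Fin N)) : ℝ :=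
  pairDensity G (Finset.univ.map Function.Embedding.inl) (Finset.univ.map Function.Embedding.inr)

/-! A bipartite graph `G` of density about `p` is constructed such that a regular equipartition of
any graph close to `G` has tower order. `G` is a blow-up of a colour class of a colouring `κ` of a
complete bipartite graph on `A` and `B`, and `κ` is built in `s`, about `log (1 / p)`, rounds that
refine the two sides alternately (`IsDesign`, `IsDesign.step`, `exists_design`). In a round each
point of `A` is replaced by `2 ^ k` copies, one for every message of a binary code whose coordinates
are the points of `B`, and each colour `f` is split into `(f, 0)` and `(f, 1)` by the bits of the
code words. The code can be so rich that `k` is proportional to the degrees of the colour classes,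
so that `A` grows to a size exponential in `|B| / 2 ^ s`, while the density of a colour class is
only halved. This gives the tower.

The codes (`exists_balanced_code`) have linear distance, so that two copies of a point differ in a
constant fraction of their neighbours. Code words are balanced on each class of the preceding
partition of `B`, and coordinates are unbiased, so that the separation of points obtained in earlier
rounds persists in the new, sparser colour classes (`SepChain.lift`). Coordinates of one colour are
pairwise independent or opposite, so that the colour classes stay uniformly distributed
(`sum_mul_sum_code_le`, `IsDesign.mixing`).

For the lower bound, let a regular equipartition of a graph `H` close to `G` be refined by the
initial partition of the design. Between two parts `H` has constant density up to small errors, and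
`H` differs from `G` in a small constant fraction of the edges of `G` (`RegularApprox`,
`IsRegularEquipartition.regularApprox`). The impurity of the parts with respect to a partition `σ`
measures how many pairs of points of one part lie in different classes of `σ` (`impurity`). Suppose
that on the right most parts lie mostly in one class of `τ`, and that the classes of `σ` on the left
are separated by `τ`. If `x`, `x'` lie in one part but in different classes of `σ`, then many edges
at `x` go to parts to which `x'` sends no edge. As `H` has constant density there, either edges
of `G` at `x` are missing in `H` or `H` has edges at `x'` that are not in `G`. If the impurity for
`σ` were a constant fraction, so would be the proportion of wrong edges
(`sum_localImpurity_mul_le`); the points outside the main class of their part do no harm, since by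
uniform distribution they meet few edges (`impurity_le_of_separates`). So small impurity passes
along the chain of partitions with no accumulating loss (`SepChain.impurity_le`), and finally holds
for the partition of the blow-up into the copies of single points. A partition whose parts
consist mostly of copies of one point has at least half as many parts as there are points
(`IsDesign.card_le`). -/

/-! ### Binary characters and codes -/

/-- The character `c ↦ (-1) ^ ⟨c, v⟩` of the group `𝔽₂ ^ k`, with `𝔽₂` written as `Bool`. -/
def chi {k : ℕ} (c v : Fin k → Bool) : ℤ := ∏ i, if c i && v i then -1 else 1

/-- The inner product `⟨c, v⟩` in `𝔽₂ ^ k`. -/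
def bit {k : ℕ} (c v : Fin k → Bool) : Bool := decide (chi c v = -1)

/-- The sign `(-1) ^ e` of an element of `𝔽₂`. -/
def sgn (e : Bool) : ℤ := if e then -1 else 1

lemma sgn_xor (a b : Bool) : sgn (xor a b) = sgn a * sgn b := by
  cases a <;> cases b <;> rfl

lemma sgn_mul_self (a : Bool) : sgn a * sgn a = 1 := by cases a <;> rfl

lemma sgn_injective : Function.Injective sgn := by
  intro a b; cases a <;> cases b <;> simp [sgn]

lemma chi_eq_or {k : ℕ} (c v : Fin k → Bool) : chi c v = 1 ∨ chi c v = -1 := by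
  unfold chi
  refine Finset.prod_induction _ (fun x : ℤ => x = 1 ∨ x = -1) ?_ (Or.inl rfl) ?_
  · rintro a b (rfl | rfl) (rfl | rfl) <;> simp
  · intro i _; split_ifs <;> simp

lemma sgn_bit {k : ℕ} (c v : Fin k → Bool) : sgn (bit c v) = chi c v := by
  unfold sgn bit
  rcases chi_eq_or c v with h | h <;> simp [h]

lemma chi_comm {k : ℕ} (c v : Fin k → Bool) : chi c v = chi v c := by
  unfold chi; simp only [Bool.and_comm]

lemma chi_mul_right {k : ℕ} (c v v' : Fin k → Bool) :
    chi c v * chi c v' = chi c (fun i => xor (v i) (v' i)) := by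
  unfold chi
  rw [← Finset.prod_mul_distrib]
  refine Finset.prod_congr rfl fun i _ => ?_
  beta_reduce
  cases c i <;> cases v i <;> cases v' i <;> rfl

lemma bit_xor_left {k : ℕ} (c c' v : Fin k → Bool) :
    xor (bit c v) (bit c' v) = bit (fun i => xor (c i) (c' i)) v := by
  apply sgn_injective
  rw [sgn_xor, sgn_bit, sgn_bit, sgn_bit, chi_comm c, chi_comm c', chi_mul_right, chi_comm]

lemma sum_chi {k : ℕ} {v : Fin k → Bool} (hv : ∃ i, v i = true) :
    ∑ c : Fin k → Bool, chi c v = 0 := by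
  obtain ⟨i, hi⟩ := hv
  have h := Fintype.prod_sum (fun (i : Fin k) (x : Bool) => if x && v i then (-1 : ℤ) else 1)
  unfold chi
  rw [← h]
  exact Finset.prod_eq_zero (Finset.mem_univ i) (by simp [hi])

lemma exists_true_of_ne {k : ℕ} {v : Fin k → Bool} (hv : v ≠ fun _ => false) :
    ∃ i, v i = true := by
  by_contra! h
  exact hv (funext fun i => by simpa using h i)

lemma sum_chi_mul_chi {k : ℕ} {v v' : Fin k → Bool} (h : v ≠ v') :
    ∑ c : Fin k → Bool, chi c v * chi c v' = 0 := by
  simp only [chi_mul_right]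
  obtain ⟨i, hi⟩ := Function.ne_iff.mp h
  exact sum_chi ⟨i, by revert hi; cases v i <;> cases v' i <;> simp⟩

/-- Greedy choice of the columns of a generator matrix. The potential is the sum over all
messages `c ≠ 0` of `16 ^ (-weight)`, where the weight is that of the code word of `c`; a random new
column multiplies it by `17 / 32` on average, and by at most `9 / 16` if the few forbidden columns
are left out. -/
lemma exists_columns (k t : ℕ) (h : 18 * (t + 1) ≤ 2 ^ k) :
    ∃ S : Finset (Fin k → Bool), S.card = t ∧ (fun _ => false) ∉ S ∧
      ∑ c ∈ Finset.univ.filter (fun c : Fin k → Bool => c ≠ fun _ => false),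
        ∏ v ∈ S, (17 + 15 * (chi c v : ℝ)) / 32 ≤ 2 ^ k * (9 / 16) ^ t := by
  induction t with
  | zero =>
    refine ⟨∅, rfl, by simp, ?_⟩
    simp only [Finset.prod_empty, Finset.sum_const, nsmul_eq_mul, mul_one, pow_zero]
    calc _ ≤ ((Finset.univ : Finset (Fin k → Bool)).card : ℝ) := by
          exact_mod_cast Finset.card_le_card (Finset.filter_subset _ _)
      _ = 2 ^ k := by simp
  | succ t ih =>
    obtain ⟨S, hS, h0, hΦ⟩ := ih (by omega)
    set Φ := ∑ c ∈ Finset.univ.filter (fun c : Fin k → Bool => c ≠ fun _ => false),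
        ∏ v ∈ S, (17 + 15 * (chi c v : ℝ)) / 32 with hΦd
    set T : Finset (Fin k → Bool) := Finset.univ \ (insert (fun _ => false) S) with hT
    have hpos : ∀ c v : Fin k → Bool, (0 : ℝ) ≤ (17 + 15 * (chi c v : ℝ)) / 32 := by
      intro c v
      rcases chi_eq_or c v with h | h <;> rw [h] <;> norm_num
    have hcard : T.card + (t + 1) = 2 ^ k := by
      rw [hT, Finset.card_sdiff_of_subset (Finset.subset_univ _), Finset.card_insert_of_notMem h0,
        hS]
      simp only [Finset.card_univ, Fintype.card_pi, Fintype.card_bool, Finset.prod_const,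
        Fintype.card_fin]
      omega
    have hΦ0 : 0 ≤ Φ := Finset.sum_nonneg fun c _ => Finset.prod_nonneg fun v _ => hpos c v
    have htot : ∑ u ∈ T, ∑ c ∈ Finset.univ.filter (fun c : Fin k → Bool => c ≠ fun _ => false),
        ((17 + 15 * (chi c u : ℝ)) / 32) * ∏ v ∈ S, (17 + 15 * (chi c v : ℝ)) / 32
        ≤ 2 ^ k * (17 / 32) * Φ := by
      rw [Finset.sum_comm, hΦd, Finset.mul_sum]
      refine Finset.sum_le_sum fun c hc => ?_
      rw [← Finset.sum_mul]
      refine mul_le_mul_of_nonneg_right ?_ (Finset.prod_nonneg fun v _ => hpos c v)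
      calc ∑ u ∈ T, (17 + 15 * (chi c u : ℝ)) / 32
          ≤ ∑ u, (17 + 15 * (chi c u : ℝ)) / 32 :=
            Finset.sum_le_sum_of_subset_of_nonneg (Finset.subset_univ _) fun u _ _ => hpos c u
        _ = 2 ^ k * (17 / 32) := by
            have hz : ∑ u : Fin k → Bool, (chi c u : ℝ) = 0 := by
              have := sum_chi (exists_true_of_ne (Finset.mem_filter.mp hc).2)
              simp only [chi_comm _ c] at this
              exact_mod_cast this
            rw [← Finset.sum_div, Finset.sum_add_distrib, ← Finset.mul_sum, hz]
            simp; ring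
    have hcR : (T.card : ℝ) + (t + 1) = 2 ^ k := by exact_mod_cast hcard
    have hkR : 18 * ((t : ℝ) + 1) ≤ 2 ^ k := by
      have : ((18 * (t + 1) : ℕ) : ℝ) ≤ ((2 ^ k : ℕ) : ℝ) := by exact_mod_cast (by omega)
      push_cast at this; exact this
    have hTne : T.Nonempty := by
      rw [← Finset.card_pos]
      have : (0 : ℝ) < T.card := by
        have : (0 : ℝ) < 2 ^ k := by positivity
        linarith
      exact_mod_cast this
    obtain ⟨u, hu, hle⟩ := Finset.exists_le_of_sum_le hTne
      (f := fun u => ∑ c ∈ Finset.univ.filter (fun c : Fin k → Bool => c ≠ fun _ => false),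
        ((17 + 15 * (chi c u : ℝ)) / 32) * ∏ v ∈ S, (17 + 15 * (chi c v : ℝ)) / 32)
      (g := fun _ => 9 / 16 * Φ) (by
        refine htot.trans ?_
        rw [Finset.sum_const, nsmul_eq_mul]
        nlinarith)
    simp only [hT, Finset.mem_sdiff, Finset.mem_univ, true_and, Finset.mem_insert, not_or] at hu
    refine ⟨insert u S, by rw [Finset.card_insert_of_notMem hu.2, hS], ?_, ?_⟩
    · simp only [Finset.mem_insert, not_or]
      exact ⟨fun h => hu.1 h.symm, h0⟩
    · simp only [Finset.prod_insert hu.2]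
      refine hle.trans ?_
      rw [pow_succ]
      linarith

/-- A linear code of length `4 k` and dimension `k` with distinct nonzero columns and relative
distance at least `1 / 16`. -/
lemma exists_linear_code (k : ℕ) (hk : 10 ≤ k) :
    ∃ S : Finset (Fin k → Bool), S.card = 4 * k ∧ (fun _ => false) ∉ S ∧
      ∀ c : Fin k → Bool, (c ≠ fun _ => false) →
        4 * k ≤ 16 * (S.filter fun v => bit c v = true).card := by
  have h18 : ∀ k : ℕ, 10 ≤ k → 18 * (4 * k + 1) ≤ 2 ^ k := by
    intro k hk
    induction k, hk using Nat.le_induction with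
    | base => norm_num
    | succ n hn ih => rw [pow_succ]; omega
  obtain ⟨S, hS, h0, hΦ⟩ := exists_columns k (4 * k) (h18 k hk)
  refine ⟨S, hS, h0, fun c hc => ?_⟩
  by_contra! hlt
  set w := (S.filter fun v => bit c v = true).card with hw
  have h1 : ∏ v ∈ S, (17 + 15 * (chi c v : ℝ)) / 32 = (1 / 16) ^ w := by
    have : ∀ v ∈ S, (17 + 15 * (chi c v : ℝ)) / 32 =
        if bit c v = true then (1 / 16 : ℝ) else 1 := by
      intro v _
      rcases chi_eq_or c v with h | h <;> simp [bit, h] <;> norm_num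
    rw [Finset.prod_congr rfl this, Finset.prod_ite, Finset.prod_const, Finset.prod_const_one,
      mul_one]
  have h2 : ((1 : ℝ) / 16) ^ w ≤ 2 ^ k * (9 / 16) ^ (4 * k) := by
    rw [← h1]
    refine le_trans ?_ hΦ
    refine Finset.single_le_sum (f := fun c => ∏ v ∈ S, (17 + 15 * (chi c v : ℝ)) / 32)
      (fun c _ => Finset.prod_nonneg fun v _ => ?_) (by simpa using hc)
    rcases chi_eq_or c v with h | h <;> rw [h] <;> norm_num
  have h3 : ((1 : ℝ) / 2) ^ k ≤ (1 / 16) ^ w := by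
    rw [show (1 / 16 : ℝ) = (1 / 2) ^ 4 by norm_num, ← pow_mul]
    exact pow_le_pow_of_le_one (by norm_num) (by norm_num) (by omega)
  have h4 : (2 : ℝ) ^ k * (9 / 16) ^ (4 * k) < (1 / 2) ^ k := by
    rw [pow_mul, ← mul_pow]
    exact pow_lt_pow_left₀ (by norm_num) (by norm_num) (by omega)
  linarith

/-! ### Codes balanced on the classes of a partition -/

open Classical in
/-- An involution that flips the label `e` and preserves `p` splits the set `p` into halves. -/
lemma two_mul_card_of_involutive {B : Type} [Fintype B] {ι : B → B} (hι : Function.Involutive ι)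
    {p : B → Prop} (hp : ∀ b, p b → p (ι b)) {e : B → Bool} (he : ∀ b, e (ι b) = !e b) (x : Bool) :
    2 * (Finset.univ.filter fun b => p b ∧ e b = x).card = (Finset.univ.filter p).card := by
  have h1 : (Finset.univ.filter fun b => p b ∧ e b = x).card
      = (Finset.univ.filter fun b => p b ∧ ¬ e b = x).card := by
    refine Finset.card_nbij' ι ι ?_ ?_ (fun b _ => hι b) (fun b _ => hι b)
    · intro b hb
      simp only [Finset.coe_filter, Finset.mem_univ, true_and, Set.mem_ofPred_eq] at hb ⊢
      exact ⟨hp b hb.1, by rw [he, hb.2]; cases x <;> simp⟩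
    · intro b hb
      simp only [Finset.coe_filter, Finset.mem_univ, true_and, Set.mem_ofPred_eq] at hb ⊢
      refine ⟨hp b hb.1, ?_⟩
      have := hb.2
      rw [he]; revert this; cases e b <;> cases x <;> simp
  have h2 := Finset.card_filter_add_card_filter_not
    (s := Finset.univ.filter p) (fun b => e b = x)
  rw [Finset.filter_filter, Finset.filter_filter] at h2
  omega

open Classical in
/-- If all classes of an equivalence relation have even size, there is an involution without
fixed points that preserves the classes. -/
lemma exists_pairing {B : Type} [Fintype B] (q : Setoid B)
    (heven : ∀ b, Even (Finset.univ.filter fun b' => q b' b).card) :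
    ∃ (ι : B → B) (e : B → Bool), Function.Involutive ι ∧ ∀ b, q (ι b) b ∧ e (ι b) = !e b := by
  have h : ∀ Q : Quotient q, ∃ m : ℕ, Nonempty ({b // Quotient.mk q b = Q} ≃ Fin m × Bool) := by
    intro Q
    induction Q using Quotient.inductionOn with
    | h b =>
      obtain ⟨m, hm⟩ := heven b
      refine ⟨m, ⟨Fintype.equivOfCardEq ?_⟩⟩
      rw [Fintype.card_subtype, Fintype.card_prod, Fintype.card_fin, Fintype.card_bool]
      have : (Finset.univ.filter fun x => Quotient.mk q x = Quotient.mk q b)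
          = Finset.univ.filter fun b' => q b' b := by
        refine Finset.filter_congr fun x _ => ?_
        rw [Quotient.eq]
      rw [this, hm]; ring
  choose m E using h
  let Ψ : B ≃ Σ Q : Quotient q, Fin (m Q) × Bool :=
    (Equiv.sigmaFiberEquiv (Quotient.mk q)).symm.trans (Equiv.sigmaCongrRight fun Q => (E Q).some)
  have hΨ : ∀ s, Quotient.mk q (Ψ.symm s) = s.1 := by
    rintro ⟨Q, s⟩
    exact ((E Q).some.symm s).2
  let F : (Σ Q : Quotient q, Fin (m Q) × Bool) → Σ Q : Quotient q, Fin (m Q) × Bool :=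
    fun s => ⟨s.1, (s.2.1, !s.2.2)⟩
  let lab : (Σ Q : Quotient q, Fin (m Q) × Bool) → Bool := fun s => s.2.2
  have hF : ∀ s, F (F s) = s := by rintro ⟨Q, i, x⟩; simp [F]
  have hlab : ∀ s, lab (F s) = !lab s := fun s => rfl
  refine ⟨fun b => Ψ.symm (F (Ψ b)), fun b => lab (Ψ b), ?_, ?_⟩
  · intro b
    simp only [Equiv.apply_symm_apply, hF, Equiv.symm_apply_apply]
  · intro b
    refine ⟨?_, by simp only [Equiv.apply_symm_apply, hlab]⟩
    rw [← Quotient.eq, hΨ]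
    conv_rhs => rw [← Ψ.symm_apply_apply b, hΨ]

open Classical in
/-- A code whose coordinates are the points of `B`, for use inside each colour class of `κ`: code
words are balanced on every class of `β` inside a colour class, are far apart on each colour class,
coordinates are unbiased, and different coordinates of one colour are independent or opposite. -/
lemma exists_balanced_code {B K : Type} [Fintype B] (κ : B → K) (β : Setoid B) (k : ℕ)
    (hk : 10 ≤ k) (hfib : ∀ f, (Finset.univ.filter fun b => κ b = f).card = 8 * k)
    (heven : ∀ b, Even (Finset.univ.filter fun b' => κ b' = κ b ∧ β b' b).card) :
    ∃ code : (Fin k → Bool) → B → Bool,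
      (∃ ι : B → B, Function.Involutive ι ∧
        ∀ b, κ (ι b) = κ b ∧ β (ι b) b ∧ ∀ c, code c (ι b) = !code c b) ∧
      (∀ c c' f, c ≠ c' →
        4 * k ≤ 8 * (Finset.univ.filter fun b => κ b = f ∧ code c b ≠ code c' b).card) ∧
      (∀ b e, 2 * (Finset.univ.filter fun c => code c b = e).card = 2 ^ k) ∧
      (∀ b b', b ≠ b' → κ b = κ b' → ∑ c, sgn (code c b) * sgn (code c b') ≤ 0) := by
  obtain ⟨S, hS, hS0, hSd⟩ := exists_linear_code k hk
  obtain ⟨ι, e, hι, hιe⟩ := exists_pairing (Setoid.ker κ ⊓ β) (by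
    intro b; convert heven b using 3; rfl)
  have hικ : ∀ b, κ (ι b) = κ b := fun b => (hιe b).1.1
  have hιβ : ∀ b, β (ι b) b := fun b => (hιe b).1.2
  have he : ∀ b, e (ι b) = !e b := fun b => (hιe b).2
  -- On the points of one colour with `e b = true`, enumerate the columns.
  have hJ : ∀ f, ∃ J : B → (Fin k → Bool),
      Set.BijOn J {b | κ b = f ∧ e b = true} S := by
    intro f
    have hc : (Finset.univ.filter fun b => κ b = f ∧ e b = true).card = S.card := by
      have := two_mul_card_of_involutive hι (p := fun b => κ b = f)
        (fun b hb => by rw [hικ, hb]) he true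
      rw [hfib] at this; omega
    let E := Finset.equivOfCardEq hc
    refine ⟨fun b => if h : b ∈ Finset.univ.filter (fun b => κ b = f ∧ e b = true) then
      (E ⟨b, h⟩ : Fin k → Bool) else fun _ => false, ?_, ?_, ?_⟩
    · intro b hb
      have hb' : b ∈ Finset.univ.filter (fun b => κ b = f ∧ e b = true) := by simpa using hb
      simp only [dif_pos hb']
      exact (E _).2
    · intro b hb b' hb' h
      have h1 : b ∈ Finset.univ.filter (fun b => κ b = f ∧ e b = true) := by simpa using hb
      have h2 : b' ∈ Finset.univ.filter (fun b => κ b = f ∧ e b = true) := by simpa using hb'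
      simp only [dif_pos h1, dif_pos h2] at h
      have := E.injective (Subtype.ext h)
      simpa using this
    · intro v hv
      have h1 := (E.symm ⟨v, hv⟩).2
      refine ⟨E.symm ⟨v, hv⟩, (Finset.mem_filter.mp h1).2, ?_⟩
      simp only [dif_pos h1]
      simp
  choose J hJ using hJ
  let rep : B → B := fun b => if e b = true then b else ι b
  let j : B → (Fin k → Bool) := fun b => J (κ b) (rep b)
  have hrep : ∀ b, κ (rep b) = κ b ∧ e (rep b) = true := by
    intro b
    by_cases hb : e b = true
    · simp [rep, hb]
    · simp [rep, hb, hικ, he]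
  have hrepι : ∀ b, rep (ι b) = rep b := by
    intro b
    by_cases hb : e b = true
    · simp [rep, hb, he, hι b]
    · simp [rep, hb, he]
  have hjι : ∀ b, j (ι b) = j b := by intro b; simp only [j, hικ, hrepι]
  have hjS : ∀ b, j b ∈ S := fun b => (hJ (κ b)).mapsTo (hrep b)
  have hjinj : ∀ b b', κ b = κ b' → j b = j b' → e b = e b' → b = b' := by
    intro b b' h1 h2 h3
    have h4 : rep b = rep b' := by
      refine (hJ (κ b)).injOn (hrep b) ?_ ?_
      · rw [h1]; exact hrep b'
      · simp only [j, ← h1] at h2; exact h2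
    by_cases hb : e b = true
    · have hb' : e b' = true := by rw [← h3]; exact hb
      simpa [rep, hb, hb'] using h4
    · have hb' : ¬ e b' = true := by rw [← h3]; exact hb
      simp only [rep, hb, hb'] at h4
      exact hι.injective h4
  refine ⟨fun c b => xor (bit c (j b)) (e b), ⟨ι, hι, fun b => ⟨hικ b, hιβ b, fun c => ?_⟩⟩,
    ?_, ?_, ?_⟩
  · beta_reduce
    rw [hjι, he]; cases bit c (j b) <;> cases e b <;> rfl
  · intro c c' f hcc
    have hd : (fun i => xor (c i) (c' i)) ≠ fun _ => false := by
      intro h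
      apply hcc
      funext i
      have := congrFun h i
      revert this
      cases c i <;> cases c' i <;> simp
    have h1 := hSd _ hd
    obtain ⟨p, hp⟩ : ∃ p : B → Prop, ∀ b, p b ↔
        κ b = f ∧ xor (bit c (j b)) (e b) ≠ xor (bit c' (j b)) (e b) := ⟨_, fun _ => Iff.rfl⟩
    have h2 := two_mul_card_of_involutive hι (p := p)
      (fun b hb => by
        rw [hp] at hb ⊢
        refine ⟨by rw [hικ, hb.1], ?_⟩
        have := hb.2
        rw [hjι, he]
        revert this
        cases bit c (j b) <;> cases bit c' (j b) <;> cases e b <;> simp) he true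
    have h3 : (S.filter fun v => bit (fun i => xor (c i) (c' i)) v = true).card
        ≤ (Finset.univ.filter fun b => p b ∧ e b = true).card := by
      refine Finset.card_le_card_of_surjOn (J f) ?_
      intro v hv
      simp only [Finset.coe_filter, Set.mem_ofPred_eq] at hv
      obtain ⟨b, ⟨hbf, hbe⟩, hbv⟩ := (hJ f).surjOn hv.1
      refine ⟨b, ?_, hbv⟩
      have hjb : j b = v := by simp only [j, rep, hbe, if_true, hbf, hbv]
      simp only [Finset.coe_filter, Finset.mem_univ, true_and, Set.mem_ofPred_eq, hp]
      refine ⟨⟨hbf, ?_⟩, hbe⟩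
      have h5 := hv.2
      rw [← bit_xor_left] at h5
      rw [hjb]
      revert h5
      cases bit c v <;> cases bit c' v <;> cases e b <;> simp
    have h6 : 4 * k ≤ 8 * (Finset.univ.filter p).card := by omega
    simp only [hp] at h6
    exact h6
  · intro b x
    have hv : j b ≠ fun _ => false := fun h => hS0 (h ▸ hjS b)
    obtain ⟨i, hi⟩ := exists_true_of_ne hv
    have := two_mul_card_of_involutive (B := Fin k → Bool)
      (ι := fun c => Function.update c i (!c i)) (p := fun _ => True)
      (e := fun c => xor (bit c (j b)) (e b))
      (fun c => by simp) (fun _ _ => trivial) (fun c => by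
        have h0 : bit (Function.update c i (!c i)) (j b) = !bit c (j b) := by
          apply sgn_injective
          have h1 : sgn (!bit c (j b)) = - sgn (bit c (j b)) := by
            cases bit c (j b) <;> rfl
          rw [h1, sgn_bit, sgn_bit]
          unfold chi
          rw [← Finset.mul_prod_erase _ _ (Finset.mem_univ i),
            ← Finset.mul_prod_erase _ (fun i => if c i && j b i then (-1 : ℤ) else 1)
              (Finset.mem_univ i)]
          have h2 : ∏ x ∈ Finset.univ.erase i,
              (if Function.update c i (!c i) x && j b x then (-1 : ℤ) else 1)
              = ∏ x ∈ Finset.univ.erase i, (if c x && j b x then (-1 : ℤ) else 1) := by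
            refine Finset.prod_congr rfl fun x hx => ?_
            rw [Function.update_of_ne (Finset.ne_of_mem_erase hx)]
          rw [h2]
          cases hc : c i <;> simp [hi]
        rw [h0]
        cases bit c (j b) <;> cases e b <;> rfl) x
    simp only [true_and, Finset.filter_true] at this
    rw [this]
    simp
  · intro b b' hbb hκ
    simp only [sgn_xor, sgn_bit]
    have hrw : ∀ c, chi c (j b) * sgn (e b) * (chi c (j b') * sgn (e b'))
        = sgn (e b) * sgn (e b') * (chi c (j b) * chi c (j b')) := fun c => by ring
    simp only [hrw, ← Finset.mul_sum]
    by_cases hj : j b = j b'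
    · have hee : e b ≠ e b' := fun h => hbb (hjinj b b' hκ hj h)
      have h1 : sgn (e b) * sgn (e b') = -1 := by
        revert hee; cases e b <;> cases e b' <;> simp [sgn]
      rw [h1, hj]
      have h2 : 0 ≤ ∑ c, chi c (j b') * chi c (j b') :=
        Finset.sum_nonneg fun c _ => mul_self_nonneg _
      linarith
    · rw [sum_chi_mul_chi hj, mul_zero]

/-! ### Separation and chains of partitions -/

open Classical in
/-- `Separates E ρ σ τ` says that in the bipartite graph `E` two points `x, x'` that lie in one
class of `ρ` but in different classes of `σ` are told apart by `τ`: at least a sixteenth of the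
neighbours of `x` lie in classes of `τ` that contain no neighbour of `x'`. -/
def Separates {A B : Type} [Fintype B] (E : A → B → Prop) (ρ σ : Setoid A) (τ : Setoid B) : Prop :=
  ∀ x x', ρ x x' → ¬ σ x x' →
    (Finset.univ.filter fun y => E x y).card ≤
      16 * (Finset.univ.filter fun y => E x y ∧ ∀ y', τ y y' → ¬ E x' y').card

lemma Separates.mono {A B : Type} [Fintype B] {E : A → B → Prop} {ρ σ : Setoid A}
    {τ τ' : Setoid B} (h : Separates E ρ σ τ) (hle : τ' ≤ τ) : Separates E ρ σ τ' := by
  classical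
  exact fun x x' hρ hσ => (h x x' hρ hσ).trans (Nat.mul_le_mul_left _ (Finset.card_le_card
    (Finset.monotone_filter_right _ fun _ _ hy => ⟨hy.1, fun y' hy' => hy.2 y' (hle hy')⟩)))

/-- The pairs of partitions of the two sides that are reached from `(ρA, ρB)`, or a coarser pair,
by refining the partition of one side at a time, each time to a partition that is separated by the
current partition of the other side. -/
inductive SepChain {A B : Type} [Fintype A] [Fintype B] (E : A → B → Prop)
    (ρA : Setoid A) (ρB : Setoid B) : Setoid A → Setoid B → Prop
  | base {σ τ} : ρA ≤ σ → ρB ≤ τ → SepChain E ρA ρB σ τ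
  | left {σ τ σ'} : SepChain E ρA ρB σ τ → σ' ≤ σ → Separates E ρA σ' τ → SepChain E ρA ρB σ' τ
  | right {σ τ τ'} : SepChain E ρA ρB σ τ → τ' ≤ τ → Separates (fun b a => E a b) ρB τ' σ →
      SepChain E ρA ρB σ τ'

lemma SepChain.swap {A B : Type} [Fintype A] [Fintype B] {E : A → B → Prop}
    {ρA : Setoid A} {ρB : Setoid B} {σ : Setoid A} {τ : Setoid B} (h : SepChain E ρA ρB σ τ) :
    SepChain (fun b a => E a b) ρB ρA τ σ := by
  induction h with
  | base h1 h2 => exact SepChain.base h2 h1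
  | left _ hle hs ih => exact SepChain.right ih hle hs
  | right _ hle hs ih => exact SepChain.left ih hle hs

open Classical in
lemma two_mul_card_prod {A C : Type} [Fintype A] [Fintype C] (R : A → Prop) (Q : A → C → Prop)
    (M : ℕ) (h : ∀ a, R a → 2 * (Finset.univ.filter fun c => Q a c).card = M) :
    2 * (Finset.univ.filter fun p : A × C => R p.1 ∧ Q p.1 p.2).card
      = M * (Finset.univ.filter R).card := by
  rw [Finset.card_filter, Fintype.sum_prod_type, Finset.card_filter, Finset.mul_sum,
    Finset.mul_sum]
  refine Finset.sum_congr rfl fun a _ => ?_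
  by_cases ha : R a
  · simp only [ha, true_and, if_true, mul_one]
    rw [← h a ha, Finset.card_filter]
  · simp [ha]

section lift

variable {A B C : Type} {E : A → B → Prop}
  {code : A → C → B → Bool} {e : Bool} {β : Setoid B} {M : ℕ}

lemma Separates.lift_left [Fintype B] {ρ σ : Setoid A} {τ : Setoid B}
    (hbal : ∀ a, ∃ ι : B → B, Function.Involutive ι ∧
      ∀ b, (E a b → E a (ι b)) ∧ β (ι b) b ∧ ∀ c, code a c (ι b) = !code a c b)
    (hβ : β ≤ τ) (h : Separates E ρ σ τ) :
    Separates (fun (p : A × C) b => E p.1 b ∧ code p.1 p.2 b = e)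
      (Setoid.comap Prod.fst ρ) (Setoid.comap Prod.fst σ) τ := by
  classical
  rintro ⟨a, c⟩ ⟨a', c'⟩ hρ hσ
  rw [Setoid.comap_rel] at hρ hσ
  obtain ⟨ι, hι, hb⟩ := hbal a
  have h1 := h a a' hρ hσ
  have h2 := two_mul_card_of_involutive hι (p := fun b => E a b) (fun b => (hb b).1)
    (fun b => (hb b).2.2 c) e
  have h3 : 2 * (Finset.univ.filter fun b =>
      (E a b ∧ ∀ y', τ b y' → ¬ E a' y') ∧ code a c b = e).card
      = (Finset.univ.filter fun b => E a b ∧ ∀ y', τ b y' → ¬ E a' y').card := by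
    convert two_mul_card_of_involutive hι
      (p := fun b => E a b ∧ ∀ y', τ b y' → ¬ E a' y')
      (fun b hp => ⟨(hb b).1 hp.1, fun y' hy' =>
        hp.2 y' (τ.trans' (τ.symm' (hβ (hb b).2.1)) hy')⟩)
      (fun b => (hb b).2.2 c) e
  have h4 : (Finset.univ.filter fun b =>
      (E a b ∧ ∀ y', τ b y' → ¬ E a' y') ∧ code a c b = e).card
      ≤ (Finset.univ.filter fun b => (E a b ∧ code a c b = e) ∧
        ∀ y', τ b y' → ¬ (E a' y' ∧ code a' c' y' = e)).card :=
    Finset.card_le_card (Finset.monotone_filter_right _ fun b _ hb' =>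
      ⟨⟨hb'.1.1, hb'.2⟩, fun y' hy' hE => hb'.1.2 y' hy' hE.1⟩)
  have h5 : (Finset.univ.filter fun b => E a b ∧ code a c b = e).card
      ≤ 16 * (Finset.univ.filter fun b => (E a b ∧ code a c b = e) ∧
        ∀ y', τ b y' → ¬ (E a' y' ∧ code a' c' y' = e)).card := by omega
  convert h5

lemma Separates.lift_right [Fintype A] [Fintype C] {ρ τ : Setoid B} {σ : Setoid A}
    (hM : ∀ a b, 2 * (Finset.univ.filter fun c => code a c b = e).card = M)
    (h : Separates (fun b a => E a b) ρ τ σ) :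
    Separates (fun b (p : A × C) => E p.1 b ∧ code p.1 p.2 b = e) ρ τ
      (Setoid.comap Prod.fst σ) := by
  classical
  intro b b' hρ hτ
  have h1 : (Finset.univ.filter fun a => E a b).card ≤
      16 * (Finset.univ.filter fun a => E a b ∧ ∀ a', σ a a' → ¬ E a' b').card := h b b' hρ hτ
  have h2 : 2 * (Finset.univ.filter fun p : A × C => E p.1 b ∧ code p.1 p.2 b = e).card
      = M * (Finset.univ.filter fun a => E a b).card := by
    convert two_mul_card_prod (fun a => E a b) (fun a c => code a c b = e) M
      (fun a _ => by convert hM a b)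
  have h3 : 2 * (Finset.univ.filter fun p : A × C =>
      (E p.1 b ∧ ∀ a', σ p.1 a' → ¬ E a' b') ∧ code p.1 p.2 b = e).card
      = M * (Finset.univ.filter fun a => E a b ∧ ∀ a', σ a a' → ¬ E a' b').card := by
    convert two_mul_card_prod (fun a => E a b ∧ ∀ a', σ a a' → ¬ E a' b')
      (fun a c => code a c b = e) M (fun a _ => by convert hM a b)
  have h4 : (Finset.univ.filter fun p : A × C =>
      (E p.1 b ∧ ∀ a', σ p.1 a' → ¬ E a' b') ∧ code p.1 p.2 b = e).card
      ≤ (Finset.univ.filter fun p : A × C => (E p.1 b ∧ code p.1 p.2 b = e) ∧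
        ∀ q : A × C, Setoid.comap Prod.fst σ p q → ¬ (E q.1 b' ∧ code q.1 q.2 b' = e)).card :=
    Finset.card_le_card (Finset.monotone_filter_right _ fun p _ hp =>
      ⟨⟨hp.1.1, hp.2⟩, fun q hq hE => hp.1.2 q.1 hq hE.1⟩)
  have h5 := Nat.mul_le_mul_left M h1
  have h6 : (Finset.univ.filter fun p : A × C => E p.1 b ∧ code p.1 p.2 b = e).card
      ≤ 16 * (Finset.univ.filter fun p : A × C => (E p.1 b ∧ code p.1 p.2 b = e) ∧
        ∀ q : A × C, Setoid.comap Prod.fst σ p q → ¬ (E q.1 b' ∧ code q.1 q.2 b' = e)).card := by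
    have h7 : M * (16 * (Finset.univ.filter fun a => E a b ∧ ∀ a', σ a a' → ¬ E a' b').card)
        = 16 * (M * (Finset.univ.filter fun a => E a b ∧ ∀ a', σ a a' → ¬ E a' b').card) := by
      ring
    omega
  convert h6

/-- Chains survive the refinement of `A` to `A × C` and of the colours by the bits of the code,
because the code is balanced on the classes of `β` and hence on those of all coarser partitions. -/
lemma SepChain.lift [Fintype A] [Fintype B] [Fintype C] {ρA σ : Setoid A} {ρB τ : Setoid B}
    (hbal : ∀ a, ∃ ι : B → B, Function.Involutive ι ∧
      ∀ b, (E a b → E a (ι b)) ∧ β (ι b) b ∧ ∀ c, code a c (ι b) = !code a c b)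
    (hM : ∀ a b, 2 * (Finset.univ.filter fun c => code a c b = e).card = M)
    (h : SepChain E ρA ρB σ τ) (hβ : β ≤ τ) :
    SepChain (fun (p : A × C) b => E p.1 b ∧ code p.1 p.2 b = e)
      (Setoid.comap Prod.fst ρA) ρB (Setoid.comap Prod.fst σ) τ := by
  induction h with
  | base h1 h2 => exact SepChain.base (fun x y hxy => h1 hxy) h2
  | left _ hle hs ih =>
    exact SepChain.left (ih hβ) (fun x y hxy => hle hxy) (hs.lift_left hbal hβ)
  | right _ hle hs ih =>
    exact SepChain.right (ih (hβ.trans hle)) hle (hs.lift_right hM)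

open Classical in
/-- After the refinement of `A` to `A × C`, different points are separated: if they differ in `C`
then by the distance of the code, and otherwise because they were separated before. -/
lemma Separates.lift_new [Fintype B] {ρ : Setoid A}
    (hbal : ∀ a, ∃ ι : B → B, Function.Involutive ι ∧
      ∀ b, (E a b → E a (ι b)) ∧ β (ι b) b ∧ ∀ c, code a c (ι b) = !code a c b)
    (hdist : ∀ a c c', c ≠ c' → (Finset.univ.filter fun b => E a b).card ≤
      16 * (Finset.univ.filter fun b => E a b ∧ code a c b ≠ code a c' b).card)
    (h : Separates E ρ ⊥ β) :
    Separates (fun (p : A × C) b => E p.1 b ∧ code p.1 p.2 b = e)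
      (Setoid.comap Prod.fst ρ) ⊥ ⊥ := by
  rintro ⟨a, c⟩ ⟨a', c'⟩ hρ hne
  by_cases haa : a = a'
  · subst haa
    have hcc : c ≠ c' := fun h => hne (by rw [h])
    obtain ⟨ι, hι, hb⟩ := hbal a
    have h1 := hdist a c c' hcc
    have h2 := two_mul_card_of_involutive hι (p := fun b => E a b) (fun b => (hb b).1)
      (fun b => (hb b).2.2 c) e
    have h3 : 2 * (Finset.univ.filter fun b =>
        (E a b ∧ code a c b ≠ code a c' b) ∧ code a c b = e).card
        = (Finset.univ.filter fun b => E a b ∧ code a c b ≠ code a c' b).card := by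
      convert two_mul_card_of_involutive hι (p := fun b => E a b ∧ code a c b ≠ code a c' b)
        (fun b hp => ⟨(hb b).1 hp.1, by rw [(hb b).2.2, (hb b).2.2]; simpa using hp.2⟩)
        (fun b => (hb b).2.2 c) e
    have h4 : (Finset.univ.filter fun b =>
        (E a b ∧ code a c b ≠ code a c' b) ∧ code a c b = e).card
        ≤ (Finset.univ.filter fun b => (E a b ∧ code a c b = e) ∧
          ∀ y', (⊥ : Setoid B) b y' → ¬ (E a y' ∧ code a c' y' = e)).card :=
      Finset.card_le_card (Finset.monotone_filter_right _ fun b _ hb' =>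
        ⟨⟨hb'.1.1, hb'.2⟩, by
          rintro y' rfl hE
          exact hb'.1.2 (hb'.2.trans hE.2.symm)⟩)
    have h5 : (Finset.univ.filter fun b => E a b ∧ code a c b = e).card
        ≤ 16 * (Finset.univ.filter fun b => (E a b ∧ code a c b = e) ∧
          ∀ y', (⊥ : Setoid B) b y' → ¬ (E a y' ∧ code a c' y' = e)).card := by omega
    convert h5
  · exact (h.lift_left (code := code) (e := e) hbal le_rfl).mono bot_le (a, c) (a', c') hρ haa

end lift

/-! ### Designs and their refinement -/

open Classical in
/-- A colouring `κ` of the complete bipartite graph between `A` and `B` such that every colour class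
is biregular of density `2 ^ (-n)` and, up to an error `n θ`, uniformly distributed, and such that
its full partitions form a chain of separated refinements of the partitions by `ρA` and `ρB`.
The design is ready for a refinement of `A`: the points of `B` fall into even groups, the classes of
`β`, by which the points of `A` are already separated. -/
structure IsDesign {A B K P : Type} [Fintype A] [Fintype B] (n : ℕ) (θ : ℝ) (κ : A → B → K)
    (ρA : A → P) (ρB : B → P) (β : Setoid B) : Prop where
  degree_left : ∀ a f, 2 ^ n * (Finset.univ.filter fun b => κ a b = f).card = Fintype.card B
  degree_right : ∀ b f, 2 ^ n * (Finset.univ.filter fun a => κ a b = f).card = Fintype.card A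
  even : ∀ a f b, Even (Finset.univ.filter fun b' => κ a b' = f ∧ β b' b).card
  mixing : ∀ f (φ : A → ℝ) (ψ : B → ℝ), (∀ a, 0 ≤ φ a ∧ φ a ≤ 1) → (∀ b, 0 ≤ ψ b ∧ ψ b ≤ 1) →
    2 ^ n * ∑ a, φ a * ∑ b ∈ Finset.univ.filter (fun b => κ a b = f), ψ b ≤
      (∑ a, φ a) * (∑ b, ψ b) + n * θ * (Fintype.card A * Fintype.card B)
  chain : ∀ f, SepChain (fun a b => κ a b = f) (Setoid.ker ρA) (Setoid.ker ρB) ⊥ β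
  separates_left : ∀ f, Separates (fun a b => κ a b = f) (Setoid.ker ρA) ⊥ β
  separates_right : ∀ f, Separates (fun b a => κ a b = f) (Setoid.ker ρB) ⊥ ⊥

/-- A code with unbiased, pairwise nonpositively correlated coordinates has small discrepancy: the
second moment of `∑ b ∈ N, φ b * s c b` over `c` is at most that of an independent sum. -/
lemma sum_mul_sum_code_le {B C : Type} [Fintype C] (N : Finset B) (s : C → B → ℝ)
    (hs : ∀ c b, s c b * s c b = 1)
    (hneg : ∀ b ∈ N, ∀ b' ∈ N, b ≠ b' → ∑ c, s c b * s c b' ≤ 0)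
    (φ : B → ℝ) (hφ : ∀ b, 0 ≤ φ b ∧ φ b ≤ 1) (ψ : C → ℝ) (hψ : ∀ c, 0 ≤ ψ c ∧ ψ c ≤ 1)
    {θ : ℝ} (hθ : 0 < θ) (hN : 1 ≤ θ ^ 2 * N.card) :
    ∑ c, ψ c * ∑ b ∈ N, φ b * s c b ≤ Fintype.card C * (θ * N.card) := by
  classical
  have hNpos : (0 : ℝ) < N.card := by
    by_contra h
    nlinarith [sq_nonneg θ]
  set g : ℝ := θ * N.card with hg
  have hgpos : 0 < g := mul_pos hθ hNpos
  have hsq : ∑ c, (∑ b ∈ N, φ b * s c b) ^ 2 ≤ Fintype.card C * N.card := by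
    calc ∑ c, (∑ b ∈ N, φ b * s c b) ^ 2
        = ∑ b ∈ N, ∑ b' ∈ N, φ b * φ b' * ∑ c, s c b * s c b' := by
          have h1 : ∀ c, (∑ b ∈ N, φ b * s c b) ^ 2
              = ∑ b ∈ N, ∑ b' ∈ N, φ b * φ b' * (s c b * s c b') := fun c => by
            rw [sq, Finset.sum_mul_sum]
            exact Finset.sum_congr rfl fun b _ => Finset.sum_congr rfl fun b' _ => by ring
          simp only [h1, Finset.mul_sum]
          rw [Finset.sum_comm]
          exact Finset.sum_congr rfl fun b _ => Finset.sum_comm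
      _ ≤ ∑ b ∈ N, ∑ b' ∈ N, if b = b' then (Fintype.card C : ℝ) else 0 := by
          refine Finset.sum_le_sum fun b hb => Finset.sum_le_sum fun b' hb' => ?_
          have h0 : 0 ≤ φ b * φ b' := mul_nonneg (hφ b).1 (hφ b').1
          have h1 : φ b * φ b' ≤ 1 := mul_le_one₀ (hφ b).2 (hφ b').1 (hφ b').2
          split_ifs with hbb
          · subst hbb
            simp only [hs, Finset.sum_const, Finset.card_univ, nsmul_eq_mul, mul_one]
            exact mul_le_of_le_one_left (Nat.cast_nonneg _) h1
          · exact mul_nonpos_of_nonneg_of_nonpos h0 (hneg b hb b' hb' hbb)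
      _ = Fintype.card C * N.card := by
          simp only [Finset.sum_ite_eq]
          rw [Finset.sum_congr rfl (fun b hb => if_pos hb), Finset.sum_const, nsmul_eq_mul,
            mul_comm]
  calc ∑ c, ψ c * ∑ b ∈ N, φ b * s c b
      ≤ ∑ c, (g / 2 + (∑ b ∈ N, φ b * s c b) ^ 2 / (2 * g)) := by
        refine Finset.sum_le_sum fun c _ => ?_
        set D := ∑ b ∈ N, φ b * s c b
        have h1 : D ≤ g / 2 + D ^ 2 / (2 * g) := by
          have h2 : g / 2 + D ^ 2 / (2 * g) - D = (D - g) ^ 2 / (2 * g) := by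
            field_simp; ring
          have : 0 ≤ (D - g) ^ 2 / (2 * g) := by positivity
          linarith
        have h3 : 0 ≤ g / 2 + D ^ 2 / (2 * g) := by positivity
        calc ψ c * D ≤ ψ c * (g / 2 + D ^ 2 / (2 * g)) := mul_le_mul_of_nonneg_left h1 (hψ c).1
          _ ≤ _ := mul_le_of_le_one_left h3 (hψ c).2
    _ = Fintype.card C * (g / 2) + (∑ c, (∑ b ∈ N, φ b * s c b) ^ 2) / (2 * g) := by
        rw [Finset.sum_add_distrib, Finset.sum_const, Finset.card_univ, nsmul_eq_mul,
          Finset.sum_div]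
    _ ≤ Fintype.card C * (g / 2) + Fintype.card C * N.card / (2 * g) := by gcongr
    _ ≤ Fintype.card C * (g / 2) + Fintype.card C * (g / 2) := by
        have : (N.card : ℝ) / (2 * g) ≤ g / 2 := by
          rw [div_le_div_iff₀ (by positivity) (by norm_num)]
          have : (N.card : ℝ) * 1 ≤ N.card * (θ ^ 2 * N.card) :=
            mul_le_mul_of_nonneg_left hN hNpos.le
          rw [hg]; nlinarith
        rw [mul_div_assoc (Fintype.card C : ℝ) (N.card : ℝ)]
        exact add_le_add le_rfl (mul_le_mul_of_nonneg_left this (Nat.cast_nonneg _))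
    _ = Fintype.card C * g := by ring

/-- One refinement step. Every point `a` of the first side is replaced by the points `(a, c)`, where
`c` runs over the messages of a balanced code on the colour classes of `a`, and the bit of the code
is appended to the colour. The sides change their roles. -/
lemma IsDesign.step {A B K P : Type} [Fintype A] [Fintype B] {n : ℕ} {θ : ℝ} {κ : A → B → K}
    {ρA : A → P} {ρB : B → P} {β : Setoid B} (h : IsDesign n θ κ ρA ρB β) (k : ℕ) (hk : 10 ≤ k)
    (hcard : 2 ^ n * (8 * k) = Fintype.card B) (hθ : 0 < θ)
    (hθk : 1 ≤ θ ^ 2 * ((8 * k : ℕ) : ℝ)) :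
    ∃ κ' : B → A × (Fin k → Bool) → K × Bool,
      IsDesign (n + 1) θ κ' ρB (ρA ∘ Prod.fst) (Setoid.ker Prod.fst) := by
  classical
  have hdeg : ∀ a f, (Finset.univ.filter fun b => κ a b = f).card = 8 * k := by
    intro a f
    have h1 := h.degree_left a f
    rw [← hcard] at h1
    exact Nat.eq_of_mul_eq_mul_left (by positivity) h1
  have hcode := fun a => exists_balanced_code (κ a) β k hk
    (fun f => by convert hdeg a f) (fun b => by convert h.even a (κ a b) b)
  choose code hι hdist hbias hcorr using hcode
  have hbal : ∀ f a, ∃ ι : B → B, Function.Involutive ι ∧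
      ∀ b, (κ a b = f → κ a (ι b) = f) ∧ β (ι b) b ∧ ∀ c, code a c (ι b) = !code a c b := by
    intro f a
    obtain ⟨ι, hinv, hb⟩ := hι a
    exact ⟨ι, hinv, fun b => ⟨fun hf => (hb b).1.trans hf, (hb b).2⟩⟩
  have hiff : ∀ b (p : A × (Fin k → Bool)) f e,
      ((κ p.1 b, code p.1 p.2 b) : K × Bool) = (f, e) ↔ κ p.1 b = f ∧ code p.1 p.2 b = e :=
    fun b p f e => Prod.mk_inj
  have hC : Fintype.card (Fin k → Bool) = 2 ^ k := by simp
  have hM : ∀ (e : Bool) a b, 2 * (Finset.univ.filter fun c => code a c b = e).card = 2 ^ k :=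
    fun e a b => by convert hbias a b e
  have hkerA : Setoid.ker (ρA ∘ (Prod.fst : A × (Fin k → Bool) → A))
      = Setoid.comap Prod.fst (Setoid.ker ρA) := rfl
  have hkerfst : (Setoid.ker (Prod.fst : A × (Fin k → Bool) → A)) = Setoid.comap Prod.fst ⊥ := rfl
  have hdist' : ∀ f a c c', c ≠ c' → (Finset.univ.filter fun b => κ a b = f).card ≤
      16 * (Finset.univ.filter fun b => κ a b = f ∧ code a c b ≠ code a c' b).card := by
    intro f a c c' hcc
    have h1 : 4 * k ≤ 8 * (Finset.univ.filter fun b => κ a b = f ∧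
        code a c b ≠ code a c' b).card := by convert hdist a c c' f hcc
    rw [hdeg]; omega
  have hsepB : ∀ f e, Separates (fun b (p : A × (Fin k → Bool)) =>
      κ p.1 b = f ∧ code p.1 p.2 b = e) (Setoid.ker ρB) ⊥ (Setoid.ker Prod.fst) := by
    intro f e
    rw [hkerfst]
    refine Separates.lift_right (M := 2 ^ k) (fun a b => ?_) (h.separates_right f)
    convert hM e a b
  have hsepA : ∀ f e, Separates (fun (p : A × (Fin k → Bool)) b =>
      κ p.1 b = f ∧ code p.1 p.2 b = e) (Setoid.comap Prod.fst (Setoid.ker ρA)) ⊥ ⊥ :=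
    fun f e => Separates.lift_new (hbal f)
      (fun a c c' hcc => by convert hdist' f a c c' hcc) (h.separates_left f)
  refine ⟨fun b p => (κ p.1 b, code p.1 p.2 b), ?_, ?_, ?_, ?_, ?_, ?_, ?_⟩
  · rintro b ⟨f, e⟩
    simp only [hiff]
    have h1 := two_mul_card_prod (fun a => κ a b = f) (fun a c => code a c b = e) (2 ^ k)
      (fun a _ => by convert hM e a b)
    have h2 : 2 * (Finset.univ.filter fun p : A × (Fin k → Bool) =>
        κ p.1 b = f ∧ code p.1 p.2 b = e).card
        = 2 ^ k * (Finset.univ.filter fun a => κ a b = f).card := by convert h1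
    have h3 : 2 ^ n * (Finset.univ.filter fun a => κ a b = f).card = Fintype.card A := by
      convert h.degree_right b f
    rw [Fintype.card_prod, hC, pow_succ, mul_assoc]
    calc _ = 2 ^ n * (2 ^ k * (Finset.univ.filter fun a => κ a b = f).card) := by
          rw [← h2]
      _ = _ := by rw [← h3]; ring
  · rintro ⟨a, c⟩ ⟨f, e⟩
    simp only [Prod.mk_inj]
    obtain ⟨ι, hinv, hb⟩ := hbal f a
    have h2 : 2 * (Finset.univ.filter fun b => κ a b = f ∧ code a c b = e).card
        = (Finset.univ.filter fun b => κ a b = f).card := by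
      convert two_mul_card_of_involutive hinv (p := fun b => κ a b = f) (fun b => (hb b).1)
        (fun b => (hb b).2.2 c) e
    rw [pow_succ, mul_assoc, h2, hdeg, hcard]
  · rintro b ⟨f, e⟩ ⟨a, c⟩
    have h2 : 2 * (Finset.univ.filter fun p : A × (Fin k → Bool) =>
        (κ p.1 b = f ∧ p.1 = a) ∧ code p.1 p.2 b = e).card
        = 2 ^ k * (Finset.univ.filter fun a' => κ a' b = f ∧ a' = a).card := by
      convert two_mul_card_prod (fun a' => κ a' b = f ∧ a' = a) (fun a c => code a c b = e) (2 ^ k)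
        (fun a _ => by convert hM e a b)
    obtain ⟨j, rfl⟩ : ∃ j, k = j + 2 := ⟨k - 2, by omega⟩
    have h3 : (Finset.univ.filter fun p : A × (Fin (j + 2) → Bool) =>
        (κ p.1 b = f ∧ p.1 = a) ∧ code p.1 p.2 b = e).card
        = 2 * (2 ^ j * (Finset.univ.filter fun a' => κ a' b = f ∧ a' = a).card) := by
      have h4 : 2 ^ (j + 2) * (Finset.univ.filter fun a' => κ a' b = f ∧ a' = a).card
        = 4 * (2 ^ j * (Finset.univ.filter fun a' => κ a' b = f ∧ a' = a).card) := by ring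
      omega
    have h5 : Even (Finset.univ.filter fun p : A × (Fin (j + 2) → Bool) =>
        (κ p.1 b = f ∧ p.1 = a) ∧ code p.1 p.2 b = e).card := by
      rw [h3]; exact even_two_mul _
    convert h5 using 3
    rw [hiff, Setoid.ker_def]
    tauto
  · rintro ⟨f, e⟩ φ ψ hφ hψ
    simp only [hiff]
    set t : ℝ := ((8 * k : ℕ) : ℝ) with ht
    have hAB : (2 : ℝ) ^ n * t = Fintype.card B := by rw [ht]; exact_mod_cast hcard
    have hCR : (Fintype.card (Fin k → Bool) : ℝ) = 2 ^ k := by exact_mod_cast hC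
    have hee : (sgn e : ℝ) * sgn e = 1 := by exact_mod_cast sgn_mul_self e
    -- The indicator of `code = e` is `(1 + sgn e * sgn code) / 2`.
    have hexp : 2 * ∑ b, φ b * ∑ p ∈ Finset.univ.filter (fun p : A × (Fin k → Bool) =>
          κ p.1 b = f ∧ code p.1 p.2 b = e), ψ p
        = ∑ a, (∑ c, ψ (a, c)) * ∑ b ∈ Finset.univ.filter (fun b => κ a b = f), φ b
          + ∑ a, ∑ c, ψ (a, c) * ∑ b ∈ Finset.univ.filter (fun b => κ a b = f),
              φ b * (sgn e * sgn (code a c b) : ℝ) := by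
      simp only [Finset.sum_mul, ← Finset.sum_add_distrib, ← mul_add]
      simp only [Finset.sum_filter, Finset.mul_sum]
      rw [Finset.sum_comm, Fintype.sum_prod_type]
      refine Finset.sum_congr rfl fun a _ => Finset.sum_congr rfl fun c _ =>
        Finset.sum_congr rfl fun b _ => ?_
      by_cases h1 : κ a b = f
      · simp only [h1, true_and, if_true]
        cases code a c b <;> cases e <;> simp [sgn] <;> ring
      · simp [h1]
    have hfirst : 2 ^ n * ∑ a, (∑ c, ψ (a, c)) *
          ∑ b ∈ Finset.univ.filter (fun b => κ a b = f), φ b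
        ≤ (∑ b, φ b) * (∑ p, ψ p)
          + n * θ * (Fintype.card A * Fintype.card B) * 2 ^ k := by
      have h1 := h.mixing f (fun a => (∑ c, ψ (a, c)) / 2 ^ k) φ (fun a => ⟨by
        have : 0 ≤ ∑ c, ψ (a, c) := Finset.sum_nonneg fun c _ => (hψ _).1
        positivity, by
        rw [div_le_one (by positivity), ← hCR]
        calc ∑ c, ψ (a, c) ≤ ∑ c : Fin k → Bool, (1 : ℝ) :=
              Finset.sum_le_sum fun c _ => (hψ _).2
          _ = _ := by simp⟩) hφ
      have h2 := mul_le_mul_of_nonneg_right h1 (by positivity : (0 : ℝ) ≤ 2 ^ k)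
      have h3 : (2 : ℝ) ^ k ≠ 0 := by positivity
      calc _ = 2 ^ n * (∑ a, (∑ c, ψ (a, c)) / 2 ^ k *
            ∑ b ∈ Finset.univ.filter (fun b => κ a b = f), φ b) * 2 ^ k := by
            rw [mul_assoc, Finset.sum_mul]
            congr 1
            refine Finset.sum_congr rfl fun a _ => ?_
            field_simp
        _ ≤ ((∑ a, (∑ c, ψ (a, c)) / 2 ^ k) * (∑ b, φ b)
            + n * θ * (Fintype.card A * Fintype.card B)) * 2 ^ k := by
            convert h2
        _ = _ := by
            rw [← Finset.sum_div, Fintype.sum_prod_type]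
            field_simp
    have hsecond : ∀ a, ∑ c, ψ (a, c) * ∑ b ∈ Finset.univ.filter (fun b => κ a b = f),
        φ b * (sgn e * sgn (code a c b) : ℝ) ≤ 2 ^ k * (θ * t) := by
      intro a
      have h1 := sum_mul_sum_code_le (Finset.univ.filter (fun b => κ a b = f))
        (fun c b => (sgn e * sgn (code a c b) : ℝ))
        (fun c b => by
          have : (sgn (code a c b) : ℝ) * sgn (code a c b) = 1 := by
            exact_mod_cast sgn_mul_self _
          calc _ = ((sgn e : ℝ) * sgn e) * ((sgn (code a c b) : ℝ) * sgn (code a c b)) := by ring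
            _ = 1 := by rw [hee, this, one_mul])
        (fun b hb b' hb' hbb => by
          have h2 := hcorr a b b' hbb
            ((Finset.mem_filter.mp hb).2.trans (Finset.mem_filter.mp hb').2.symm)
          have h3 : (∑ c, (sgn (code a c b) : ℝ) * sgn (code a c b')) ≤ 0 := by exact_mod_cast h2
          refine le_trans (le_of_eq ?_) h3
          refine Finset.sum_congr rfl fun c _ => ?_
          calc _ = ((sgn e : ℝ) * sgn e) * ((sgn (code a c b) : ℝ) * sgn (code a c b')) := by ring
            _ = _ := by rw [hee, one_mul])
        φ hφ (fun c => ψ (a, c)) (fun c => hψ _) hθ (by rw [hdeg]; exact hθk)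
      rw [hdeg, hCR] at h1
      exact h1
    have hsum : ∑ a, ∑ c, ψ (a, c) * ∑ b ∈ Finset.univ.filter (fun b => κ a b = f),
        φ b * (sgn e * sgn (code a c b) : ℝ) ≤ Fintype.card A * (2 ^ k * (θ * t)) := by
      refine (Finset.sum_le_sum fun a _ => hsecond a).trans ?_
      rw [Finset.sum_const, Finset.card_univ, nsmul_eq_mul]
    have h4 : (Fintype.card (A × (Fin k → Bool)) : ℝ) = Fintype.card A * 2 ^ k := by
      rw [Fintype.card_prod]; push_cast; rw [← hCR]
    calc _ = 2 ^ n * (2 * ∑ b, φ b * ∑ p ∈ Finset.univ.filter (fun p : A × (Fin k → Bool) =>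
          κ p.1 b = f ∧ code p.1 p.2 b = e), ψ p) := by rw [pow_succ, mul_assoc]
      _ ≤ ((∑ b, φ b) * (∑ p, ψ p) + n * θ * (Fintype.card A * Fintype.card B) * 2 ^ k)
          + 2 ^ n * (Fintype.card A * (2 ^ k * (θ * t))) := by
          rw [hexp, mul_add]
          exact add_le_add hfirst (mul_le_mul_of_nonneg_left hsum (by positivity))
      _ = _ := by
          rw [h4, ← hAB]; push_cast; ring
  · rintro ⟨f, e⟩
    simp only [hiff, hkerA]
    have h1 : SepChain (fun (p : A × (Fin k → Bool)) b => κ p.1 b = f ∧ code p.1 p.2 b = e)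
        (Setoid.comap Prod.fst (Setoid.ker ρA)) (Setoid.ker ρB) (Setoid.ker Prod.fst) β :=
      (h.chain f).lift (hbal f) (M := 2 ^ k) (fun a b => by convert hM e a b) le_rfl
    exact (SepChain.right h1 bot_le (hsepB f e)).swap
  · rintro ⟨f, e⟩
    simp only [hiff]
    exact hsepB f e
  · rintro ⟨f, e⟩
    simp only [hiff, hkerA]
    exact hsepA f e

/-- The design with one colour, in which both sides are copies of `P`. -/
lemma isDesign_trivial (P : Type) [Fintype P] (hP : Even (Fintype.card P)) (θ : ℝ) :
    IsDesign 0 θ (fun (_ _ : P) => ()) id id ⊤ := by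
  classical
  have hker : Setoid.ker (id : P → P) ≤ ⊥ := fun x y hxy => hxy
  have hsep : ∀ τ : Setoid P, Separates (fun _ _ : P => () = ()) (Setoid.ker id) ⊥ τ :=
    fun τ x x' hxx hne => absurd hxx hne
  refine ⟨?_, ?_, ?_, ?_, fun _ => SepChain.base hker le_top, fun _ => hsep _, fun _ => hsep _⟩
  · intro a f; simp
  · intro a f; simp
  · intro a f b
    have : (Finset.univ.filter fun b' : P => () = f ∧ (⊤ : Setoid P) b' b) = Finset.univ :=
      Finset.filter_true_of_mem fun x _ => ⟨rfl, trivial⟩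
    convert hP
    rw [← Finset.card_univ, ← this]
    congr
  · intro f φ ψ _ _
    simp [Finset.sum_mul]

lemma le_towerNat (n : ℕ) : n + 1 ≤ towerNat n := by
  induction n with
  | zero => simp [towerNat]
  | succ n ih =>
    rw [towerNat]
    have := Nat.lt_two_pow_self (n := towerNat n)
    omega

lemma towerNat_mono : Monotone towerNat := by
  refine monotone_nat_of_le_succ fun n => ?_
  rw [towerNat]
  exact Nat.lt_two_pow_self.le

/-- Designs with `2 ^ n` colours exist in which one side is of tower size. -/
lemma exists_design (h : ℕ) (hh : 4 ≤ h) (n : ℕ) :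
    ∃ (A B K : Type) (_ : Fintype A) (_ : Fintype B) (_ : Fintype K) (κ : A → B → K)
      (ρA : A → Fin (2 ^ (2 * h))) (ρB : B → Fin (2 ^ (2 * h))) (β : Setoid B) (a b : ℕ),
      IsDesign n (1 / 2 ^ h) κ ρA ρB β ∧ Fintype.card K = 2 ^ n ∧
      Fintype.card A = 2 ^ a ∧ Fintype.card B = 2 ^ b ∧ 2 * h ≤ a ∧
      towerNat n + 2 * h + n ≤ b + 1 := by
  induction n with
  | zero =>
    refine ⟨Fin (2 ^ (2 * h)), Fin (2 ^ (2 * h)), Unit, inferInstance, inferInstance,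
      inferInstance, fun _ _ => (), id, id, ⊤, 2 * h, 2 * h, isDesign_trivial _ ?_ _, ?_, ?_, ?_,
      le_rfl, ?_⟩
    · rw [Fintype.card_fin]
      exact (Nat.even_pow.mpr ⟨even_two, by omega⟩)
    · simp
    · simp
    · simp
    · simp [towerNat]; omega
  | succ n ih =>
    obtain ⟨A, B, K, _, _, _, κ, ρA, ρB, β, a, b, hd, hK, hA, hB, ha, hb⟩ := ih
    have hT := le_towerNat n
    have hT' := Nat.lt_two_pow_self (n := towerNat n)
    obtain ⟨j, rfl⟩ : ∃ j, b = n + 3 + j := ⟨b - (n + 3), by omega⟩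
    have hk : 10 ≤ 2 ^ j := by
      calc 10 ≤ 2 ^ 4 := by norm_num
        _ ≤ 2 ^ j := Nat.pow_le_pow_right (by norm_num) (by omega)
    obtain ⟨κ', hκ'⟩ := hd.step (2 ^ j) hk (by rw [hB]; ring) (by positivity) (by
      push_cast
      rw [div_pow, one_pow, ← pow_mul, div_mul_eq_mul_div, one_mul, le_div_iff₀ (by positivity),
        one_mul, show (8 : ℝ) = 2 ^ 3 by norm_num, ← pow_add]
      exact pow_le_pow_right₀ (by norm_num) (by omega))
    refine ⟨B, A × (Fin (2 ^ j) → Bool), K × Bool, inferInstance, inferInstance, inferInstance,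
      κ', _, _, _, n + 3 + j, a + 2 ^ j, hκ', ?_, hB, ?_, by omega, ?_⟩
    · simp [hK, pow_succ]
    · simp [hA, pow_add]
    · have h1 : 2 * 2 ^ towerNat n ≤ 2 ^ j := by
        rw [← pow_succ']
        exact Nat.pow_le_pow_right (by norm_num) (by omega)
      rw [towerNat]
      omega

/-! ### Impurity of a partition -/

section counting

variable {L R I J : Type} [Fintype L] [Fintype R]

open Classical in
/-- The number of pairs of `S × T` that are related by `H`. -/
noncomputable def edgeCount (H : L → R → Prop) (S : Finset L) (T : Finset R) : ℕ :=
  ((S ×ˢ T).filter fun p => H p.1 p.2).card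

open Classical in
/-- The proportion of the points in the part of `x`, for the partition into the fibres of `z`, that
lie in another class of `σ` than `x`. -/
noncomputable def localImpurity (z : L → I) (σ : Setoid L) (x : L) : ℝ :=
  ((Finset.univ.filter fun x' => z x' = z x ∧ ¬ σ x x').card : ℝ) /
    ((Finset.univ.filter fun x' => z x' = z x).card : ℝ)

/-- The total (Gini) impurity of the fibres of `z` with respect to the classes of `σ`: it vanishes
if every fibre of `z` lies in one class, and is at most the number of points. -/
noncomputable def impurity (z : L → I) (σ : Setoid L) : ℝ := ∑ x, localImpurity z σ x

open Classical in
/-- Up to the error terms `ℓ i j` the graph `H` has constant density between the fibres of `z` and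
those of `w`, and the number of pairs in which `G` and `H` differ, together with all these error
terms counted twice, is at most `D`. -/
def RegularApprox [Fintype I] [Fintype J] (G H : L → R → Prop) (z : L → I) (w : R → J) (D : ℝ) :
    Prop :=
  ∃ ℓ : I → J → ℝ, (∀ i j, ∃ d : ℝ, ∀ (S : Finset L) (T : Finset R),
      (∀ x ∈ S, z x = i) → (∀ y ∈ T, w y = j) →
        |(edgeCount H S T : ℝ) - d * (S.card * T.card)| ≤ ℓ i j) ∧
    ((Finset.univ.filter fun p : L × R => ¬ (G p.1 p.2 ↔ H p.1 p.2)).card : ℝ) +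
      2 * ∑ i, ∑ j, ℓ i j ≤ D

omit [Fintype L] [Fintype R] in
lemma edgeCount_swap (H : L → R → Prop) (S : Finset L) (T : Finset R) :
    edgeCount (fun y x => H x y) T S = edgeCount H S T := by
  classical
  unfold edgeCount
  refine Finset.card_nbij' Prod.swap Prod.swap ?_ ?_ (fun _ _ => rfl) (fun _ _ => rfl)
  · rintro ⟨y, x⟩ h; simp at h ⊢; tauto
  · rintro ⟨y, x⟩ h; simp at h ⊢; tauto

lemma RegularApprox.swap [Fintype I] [Fintype J] {G H : L → R → Prop} {z : L → I} {w : R → J}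
    {D : ℝ} (h : RegularApprox G H z w D) :
    RegularApprox (fun y x => G x y) (fun y x => H x y) w z D := by
  classical
  obtain ⟨ℓ, h1, h2⟩ := h
  refine ⟨fun j i => ℓ i j, fun j i => ?_, ?_⟩
  · obtain ⟨d, h⟩ := h1 i j
    refine ⟨d, fun T S hT hS => ?_⟩
    rw [edgeCount_swap, mul_comm (T.card : ℝ)]
    exact h S T hS hT
  · rw [Finset.sum_comm]
    refine le_trans (le_of_eq ?_) h2
    congr 2
    refine Finset.card_nbij' Prod.swap Prod.swap ?_ ?_ (fun _ _ => rfl) (fun _ _ => rfl)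
    · rintro ⟨y, x⟩ h; simpa using h
    · rintro ⟨y, x⟩ h; simpa using h

lemma localImpurity_nonneg (z : L → I) (σ : Setoid L) (x : L) : 0 ≤ localImpurity z σ x := by
  unfold localImpurity; positivity

lemma localImpurity_le_one (z : L → I) (σ : Setoid L) (x : L) : localImpurity z σ x ≤ 1 := by
  classical
  unfold localImpurity
  refine div_le_one_of_le₀ ?_ (by positivity)
  have : (Finset.univ.filter fun x' => z x' = z x ∧ ¬ σ x x').card
      ≤ (Finset.univ.filter fun x' => z x' = z x).card :=
    Finset.card_le_card (Finset.monotone_filter_right _ fun _ _ h => h.1)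
  exact_mod_cast this

lemma impurity_eq_zero (z : L → I) (σ : Setoid L) (h : ∀ x x', z x = z x' → σ x x') :
    impurity z σ = 0 := by
  classical
  refine Finset.sum_eq_zero fun x _ => ?_
  unfold localImpurity
  rw [Finset.filter_false_of_mem (p := fun x' => z x' = z x ∧ ¬ σ x x')
    (fun x' _ hx' => hx'.2 (h _ _ hx'.1.symm))]
  simp

open Classical in
/-- Every fibre of `w` contains a point such that in total at most the impurity lies outside the
classes of these points. -/
lemma exists_representatives [Nonempty R] [Fintype J] (w : R → J) (τ : Setoid R) :
    ∃ r : J → R, ((Finset.univ.filter fun y => ¬ τ y (r (w y))).card : ℝ) ≤ impurity w τ := by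
  have h : ∀ j, ∃ y₀, ((Finset.univ.filter fun y => w y = j ∧ ¬ τ y y₀).card : ℝ) ≤
      ∑ y ∈ Finset.univ.filter (fun y => w y = j), localImpurity w τ y := by
    intro j
    by_cases hj : (Finset.univ.filter fun y => w y = j).Nonempty
    · obtain ⟨y₀, _, hle⟩ := Finset.exists_le_of_sum_le hj
        (f := fun y₀ => ((Finset.univ.filter fun y => w y = j ∧ ¬ τ y y₀).card : ℝ))
        (g := fun _ => ∑ y ∈ Finset.univ.filter (fun y => w y = j), localImpurity w τ y) (by
          rw [Finset.sum_const, nsmul_eq_mul, Finset.mul_sum]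
          refine Finset.sum_le_sum fun y hy => ?_
          have hy' : w y = j := (Finset.mem_filter.mp hy).2
          have h0 : ((Finset.univ.filter fun y => w y = j).card : ℝ) ≠ 0 := by
            exact_mod_cast hj.card_pos.ne'
          unfold localImpurity
          rw [hy', mul_div_cancel₀ _ h0]
          have h1 : (Finset.univ.filter fun y' => w y' = j ∧ ¬ τ y' y)
              = Finset.univ.filter fun y' => w y' = j ∧ ¬ τ y y' :=
            Finset.filter_congr fun y' _ => by rw [τ.comm']
          rw [h1])
      exact ⟨y₀, hle⟩
    · rw [Finset.not_nonempty_iff_eq_empty] at hj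
      refine ⟨Classical.arbitrary R, ?_⟩
      rw [hj, ← Finset.filter_filter, hj]
      simp
  choose r hr using h
  refine ⟨r, ?_⟩
  rw [Finset.card_eq_sum_card_fiberwise (f := w) (t := Finset.univ) (fun _ _ => Finset.mem_univ _)]
  unfold impurity
  rw [← Finset.sum_fiberwise Finset.univ w]
  push_cast
  refine Finset.sum_le_sum fun j _ => le_trans (le_of_eq ?_) (hr j)
  rw [Finset.filter_filter]
  congr 2
  refine Finset.filter_congr fun y _ => ?_
  constructor
  · rintro ⟨h1, h2⟩; exact ⟨h2, h2 ▸ h1⟩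
  · rintro ⟨h1, h2⟩; exact ⟨h1 ▸ h2, h1⟩

omit [Fintype L] [Fintype R] in
/-- The cost of a pair `(Z, T)` of constant density in `H`: if no edge of `G` joins `D ⊆ Z` to `T`,
then the edges of `H` between `D` and `T` are wrong, while few edges of `H` between `Z` and `T` mean
that many edges of `G` are missing. -/
lemma card_mul_edgeCount_le (G H : L → R → Prop) {D Z : Finset L} {T : Finset R} (hDZ : D ⊆ Z)
    (hD : ∀ x ∈ D, ∀ y ∈ T, ¬ G x y) {d ℓ : ℝ}
    (hZT : |(edgeCount H Z T : ℝ) - d * (Z.card * T.card)| ≤ ℓ)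
    (hDT : |(edgeCount H D T : ℝ) - d * (D.card * T.card)| ≤ ℓ) :
    (D.card : ℝ) * edgeCount G Z T ≤
      Z.card * (edgeCount (fun x y => ¬ (G x y ↔ H x y)) Z T + 2 * ℓ) := by
  classical
  have h1 : edgeCount G Z T ≤ edgeCount (fun x y => G x y ∧ ¬ H x y) Z T + edgeCount H Z T := by
    unfold edgeCount
    refine le_trans (Finset.card_le_card ?_) (Finset.card_union_le _ _)
    intro p hp
    simp only [Finset.mem_filter, Finset.mem_union] at hp ⊢
    tauto
  have h2 : edgeCount (fun x y => G x y ∧ ¬ H x y) Z T + edgeCount H D T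
      ≤ edgeCount (fun x y => ¬ (G x y ↔ H x y)) Z T := by
    unfold edgeCount
    rw [← Finset.card_union_of_disjoint]
    · refine Finset.card_le_card ?_
      intro p hp
      simp only [Finset.mem_filter, Finset.mem_union, Finset.mem_product] at hp ⊢
      rcases hp with hp | hp
      · tauto
      · have := hD _ hp.1.1 _ hp.1.2
        exact ⟨⟨hDZ hp.1.1, hp.1.2⟩, by tauto⟩
    · rw [Finset.disjoint_left]
      intro p hp hp'
      simp only [Finset.mem_filter, Finset.mem_product] at hp hp'
      exact hp.2.2 hp'.2
  have h1' : (edgeCount G Z T : ℝ) ≤ edgeCount (fun x y => G x y ∧ ¬ H x y) Z T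
      + edgeCount H Z T := by exact_mod_cast h1
  have h2' : (edgeCount (fun x y => G x y ∧ ¬ H x y) Z T : ℝ) + edgeCount H D T
      ≤ edgeCount (fun x y => ¬ (G x y ↔ H x y)) Z T := by exact_mod_cast h2
  have hcard : (D.card : ℝ) ≤ Z.card := by exact_mod_cast Finset.card_le_card hDZ
  have hD0 : (0 : ℝ) ≤ D.card := by positivity
  have hℓ : 0 ≤ ℓ := (abs_nonneg _).trans hZT
  set c₁ : ℝ := ((edgeCount (fun x y => G x y ∧ ¬ H x y) Z T : ℕ) : ℝ)
  have hc₁ : 0 ≤ c₁ := by positivity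
  rw [abs_le] at hZT hDT
  calc (D.card : ℝ) * edgeCount G Z T
      ≤ D.card * (c₁ + ℓ) + Z.card * (d * (D.card * T.card)) := by
        have := mul_le_mul_of_nonneg_left
          (show (edgeCount G Z T : ℝ) ≤ c₁ + ℓ + d * (Z.card * T.card) by linarith) hD0
        linarith
    _ ≤ Z.card * (c₁ + ℓ) + Z.card * (edgeCount H D T + ℓ) := by
        refine add_le_add (mul_le_mul_of_nonneg_right hcard (by linarith)) ?_
        exact mul_le_mul_of_nonneg_left (by linarith) (by positivity)
    _ = Z.card * (c₁ + edgeCount H D T + 2 * ℓ) := by ring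
    _ ≤ _ := mul_le_mul_of_nonneg_left (by linarith) (by positivity)

open Classical in
/-- The cost of impurity: a point `y` outside the exceptional set is a neighbour of `x` but not
joined to `x'` by way of its class, for at least `deg x / 16` minus the number of exceptional
neighbours; averaging over `x, x'` in a fibre of `z` gives the density of wrong pairs. -/
lemma sum_localImpurity_mul_le [Fintype I] [Fintype J] {G H : L → R → Prop} {z : L → I}
    {w : R → J} {D : ℝ} (hreg : RegularApprox G H z w D) {ρ σ : Setoid L} {τ : Setoid R}
    (hz : ∀ x x', z x = z x' → ρ x x') (hsep : Separates G ρ σ τ) (r : J → R) :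
    ∑ x, localImpurity z σ x * (((Finset.univ.filter fun y => G x y).card : ℝ) / 16 -
      ((Finset.univ.filter fun y => ¬ τ y (r (w y)) ∧ G x y).card : ℝ)) ≤ D := by
  obtain ⟨ℓ, hℓ, hD⟩ := hreg
  set g : L → ℝ := fun x => ((Finset.univ.filter fun y => G x y).card : ℝ) / 16 -
      ((Finset.univ.filter fun y => ¬ τ y (r (w y)) ∧ G x y).card : ℝ) with hg
  let Z : I → Finset L := fun i => Finset.univ.filter fun x => z x = i
  let T : J → Finset R := fun j => Finset.univ.filter fun y => w y = j ∧ τ y (r j)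
  let N : I → J → Finset L := fun i j =>
    (Z i).filter fun x => ∀ y', τ (r j) y' → ¬ G x y'
  let F : L → L → ℕ := fun x x' => (Finset.univ.filter fun y =>
    τ y (r (w y)) ∧ G x y ∧ ∀ y', τ y y' → ¬ G x' y').card
  let cost : I → J → ℕ := fun i j => edgeCount (fun x y => ¬ (G x y ↔ H x y)) (Z i) (T j)
  have hmemZ : ∀ i x, x ∈ Z i ↔ z x = i := fun i x => by simp [Z]
  have hF : ∀ x x', ρ x x' → ¬ σ x x' → g x ≤ F x x' := by
    intro x x' hρ hσ
    have h1 := hsep x x' hρ hσ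
    have h2 : (Finset.univ.filter fun y => G x y ∧ ∀ y', τ y y' → ¬ G x' y').card
        ≤ F x x' + (Finset.univ.filter fun y => ¬ τ y (r (w y)) ∧ G x y).card := by
      refine le_trans (Finset.card_le_card ?_) (Finset.card_union_le _ _)
      intro y hy
      simp only [Finset.mem_filter, Finset.mem_univ, true_and, Finset.mem_union] at hy ⊢
      by_cases hy' : τ y (r (w y))
      · exact Or.inl ⟨hy', hy⟩
      · exact Or.inr ⟨hy', hy.1⟩
    have h3 : (Finset.univ.filter fun y => G x y).card ≤ 16 * (F x x' +
        (Finset.univ.filter fun y => ¬ τ y (r (w y)) ∧ G x y).card) := by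
      refine le_trans ?_ (Nat.mul_le_mul_left 16 h2)
      convert h1
    have h4 : ((Finset.univ.filter fun y => G x y).card : ℝ) ≤ 16 * (F x x' +
        (Finset.univ.filter fun y => ¬ τ y (r (w y)) ∧ G x y).card) := by exact_mod_cast h3
    simp only [hg]
    linarith
  have hpair : ∀ i j, ((N i j).card : ℝ) * edgeCount G (Z i) (T j) ≤
      (Z i).card * (cost i j + 2 * ℓ i j) := by
    intro i j
    obtain ⟨d, hdℓ⟩ := hℓ i j
    have hTj : ∀ y ∈ T j, w y = j := fun y hy => (Finset.mem_filter.mp hy).2.1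
    refine card_mul_edgeCount_le G H (Finset.filter_subset _ _) ?_
      (hdℓ _ _ (fun x hx => (hmemZ i x).mp hx) hTj)
      (hdℓ _ _ (fun x hx => (hmemZ i x).mp (Finset.filter_subset _ _ hx)) hTj)
    intro x hx y hy
    exact (Finset.mem_filter.mp hx).2 y (τ.symm' (Finset.mem_filter.mp hy).2.2)
  have hdouble : ∀ i, ∑ x ∈ Z i, ∑ x' ∈ Z i, (F x x' : ℝ)
      = ∑ j, ((N i j).card : ℝ) * edgeCount G (Z i) (T j) := by
    intro i
    have h1 : ∀ x x', x' ∈ Z i → F x x' = ∑ j, if x' ∈ N i j then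
        ((T j).filter fun y => G x y).card else 0 := by
      intro x x' hx'
      rw [show F x x' = _ from Finset.card_eq_sum_card_fiberwise (f := w) (t := Finset.univ)
        (fun _ _ => Finset.mem_univ _)]
      refine Finset.sum_congr rfl fun j _ => ?_
      split_ifs with hN
      · congr 1
        ext y
        simp only [Finset.mem_filter, Finset.mem_univ, true_and, T]
        constructor
        · rintro ⟨⟨h1, h2, -⟩, rfl⟩; exact ⟨⟨rfl, h1⟩, h2⟩
        · rintro ⟨⟨rfl, h1⟩, h2⟩
          exact ⟨⟨h1, h2, fun y' hy' =>
            (Finset.mem_filter.mp hN).2 y' (τ.trans' (τ.symm' h1) hy')⟩, rfl⟩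
      · rw [Finset.card_eq_zero, Finset.filter_eq_empty_iff]
        intro y hy hyj
        simp only [Finset.mem_filter, Finset.mem_univ, true_and] at hy
        subst hyj
        exact hN (Finset.mem_filter.mpr ⟨hx', fun y' hy' =>
          hy.2.2 y' (τ.trans' hy.1 hy')⟩)
    have h2 : ∀ j, edgeCount G (Z i) (T j) = ∑ x ∈ Z i, ((T j).filter fun y => G x y).card := by
      intro j
      unfold edgeCount
      rw [Finset.card_filter, Finset.sum_product]
      refine Finset.sum_congr rfl fun x _ => ?_
      rw [Finset.card_filter]
    have h3 : ∑ x ∈ Z i, ∑ x' ∈ Z i, F x x' = ∑ j, (N i j).card * edgeCount G (Z i) (T j) := by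
      calc ∑ x ∈ Z i, ∑ x' ∈ Z i, F x x'
          = ∑ x ∈ Z i, ∑ x' ∈ Z i, ∑ j, (if x' ∈ N i j then
              ((T j).filter fun y => G x y).card else 0) :=
            Finset.sum_congr rfl fun x _ => Finset.sum_congr rfl fun x' hx' => h1 x x' hx'
        _ = ∑ x ∈ Z i, ∑ j, (N i j).card * ((T j).filter fun y => G x y).card := by
            refine Finset.sum_congr rfl fun x _ => ?_
            rw [Finset.sum_comm]
            refine Finset.sum_congr rfl fun j _ => ?_
            rw [← Finset.sum_filter, Finset.sum_const, smul_eq_mul]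
            congr 2
            ext x'
            simp only [Finset.mem_filter, N]
            tauto
        _ = _ := by
            rw [Finset.sum_comm]
            refine Finset.sum_congr rfl fun j _ => ?_
            rw [h2, Finset.mul_sum]
    exact_mod_cast h3
  have hi : ∀ i, ∑ x ∈ Z i, localImpurity z σ x * g x ≤ ∑ j, ((cost i j : ℝ) + 2 * ℓ i j) := by
    intro i
    rcases (Z i).eq_empty_or_nonempty with hZ | hZ
    · rw [hZ, Finset.sum_empty]
      refine Finset.sum_nonneg fun j _ => ?_
      obtain ⟨d, hdℓ⟩ := hℓ i j
      have := (abs_nonneg _).trans (hdℓ ∅ ∅ (by simp) (by simp))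
      positivity
    · have hpos : (0 : ℝ) < (Z i).card := by exact_mod_cast hZ.card_pos
      rw [← mul_le_mul_iff_right₀ hpos, Finset.mul_sum, Finset.mul_sum]
      calc ∑ x ∈ Z i, (Z i).card * (localImpurity z σ x * g x)
          = ∑ x ∈ Z i, ∑ x' ∈ (Z i).filter (fun x' => ¬ σ x x'), g x := by
            refine Finset.sum_congr rfl fun x hx => ?_
            rw [Finset.sum_const, nsmul_eq_mul, ← mul_assoc]
            congr 1
            unfold localImpurity
            rw [(hmemZ i x).mp hx, mul_div_cancel₀ _ hpos.ne', Finset.filter_filter]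
        _ ≤ ∑ x ∈ Z i, ∑ x' ∈ (Z i).filter (fun x' => ¬ σ x x'), (F x x' : ℝ) := by
            refine Finset.sum_le_sum fun x hx => Finset.sum_le_sum fun x' hx' => ?_
            rw [Finset.mem_filter] at hx'
            refine hF x x' (hz _ _ ?_) hx'.2
            rw [(hmemZ i x).mp hx, (hmemZ i x').mp hx'.1]
        _ ≤ ∑ x ∈ Z i, ∑ x' ∈ Z i, (F x x' : ℝ) :=
            Finset.sum_le_sum fun x _ => Finset.sum_le_sum_of_subset_of_nonneg
              (Finset.filter_subset _ _) fun _ _ _ => Nat.cast_nonneg _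
        _ = ∑ j, ((N i j).card : ℝ) * edgeCount G (Z i) (T j) := hdouble i
        _ ≤ ∑ j, ((Z i).card : ℝ) * (cost i j + 2 * ℓ i j) :=
            Finset.sum_le_sum fun j _ => hpair i j
  have hcost : ∑ i, ∑ j, cost i j
      ≤ (Finset.univ.filter fun p : L × R => ¬ (G p.1 p.2 ↔ H p.1 p.2)).card := by
    rw [Finset.card_eq_sum_card_fiberwise (f := fun p : L × R => (z p.1, w p.2))
      (t := Finset.univ) (fun _ _ => Finset.mem_univ _), Fintype.sum_prod_type]
    refine Finset.sum_le_sum fun i _ => Finset.sum_le_sum fun j _ => Finset.card_le_card ?_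
    intro p hp
    simp only [Finset.mem_filter, Finset.mem_product, Finset.mem_univ, true_and, Z, T] at hp ⊢
    exact ⟨hp.2, by rw [hp.1.1, hp.1.2.1]⟩
  calc ∑ x, localImpurity z σ x * g x
      = ∑ i, ∑ x ∈ Z i, localImpurity z σ x * g x := (Finset.sum_fiberwise Finset.univ z _).symm
    _ ≤ ∑ i, ∑ j, ((cost i j : ℝ) + 2 * ℓ i j) := Finset.sum_le_sum fun i _ => hi i
    _ = ((∑ i, ∑ j, cost i j : ℕ) : ℝ) + 2 * ∑ i, ∑ j, ℓ i j := by
        push_cast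
        simp only [Finset.sum_add_distrib, Finset.mul_sum]
    _ ≤ _ := le_trans (add_le_add_left (by exact_mod_cast hcost) _) hD

open Classical in
/-- One step along a chain: a partition of `L` separated by a partition of `R` of small impurity
has small impurity. -/
lemma impurity_le_of_separates [Nonempty R] [Fintype I] [Fintype J] {G H : L → R → Prop}
    {z : L → I} {w : R → J} {D : ℝ} (hreg : RegularApprox G H z w D) {ρ σ : Setoid L}
    {τ : Setoid R} (hz : ∀ x x', z x = z x' → ρ x x') (hsep : Separates G ρ σ τ)
    {Δ : ℕ} {η : ℝ} (hΔ : 0 < Δ) (hdeg : ∀ x, (Finset.univ.filter fun y => G x y).card = Δ)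
    (hmix : ∀ (φ : L → ℝ) (T : Finset R), (∀ x, 0 ≤ φ x ∧ φ x ≤ 1) →
      32 * (T.card : ℝ) ≤ Fintype.card R →
      ∑ x, φ x * ((T.filter fun y => G x y).card : ℝ) ≤ Δ / 32 * ∑ x, φ x + η)
    (hη : D + η ≤ Δ * Fintype.card L / 1024)
    (hτ : 32 * impurity w τ ≤ Fintype.card R) : 32 * impurity z σ ≤ Fintype.card L := by
  obtain ⟨r, hr⟩ := exists_representatives w τ
  have h1 := sum_localImpurity_mul_le hreg hz hsep r
  have h2 := hmix (localImpurity z σ) (Finset.univ.filter fun y => ¬ τ y (r (w y)))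
    (fun x => ⟨localImpurity_nonneg _ _ _, localImpurity_le_one _ _ _⟩) (by linarith)
  simp only [Finset.filter_filter] at h2
  simp only [hdeg, mul_sub, Finset.sum_sub_distrib, ← Finset.sum_mul] at h1
  have hΔ' : (0 : ℝ) < Δ := by exact_mod_cast hΔ
  change ∑ x, localImpurity z σ x * _ ≤ Δ / 32 * impurity z σ + η at h2
  change impurity z σ * _ - _ ≤ D at h1
  have h3 : (Δ : ℝ) * (32 * impurity z σ) ≤ Δ * Fintype.card L := by linarith
  exact le_of_mul_le_mul_left h3 hΔ'

/-- If all classes of `σ` have at most `M` points, then a partition of small impurity needs many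
parts. -/
lemma card_le_of_impurity_le [Fintype I] {z : L → I} {σ : Setoid L}
    (h : 32 * impurity z σ ≤ Fintype.card L) {M : ℕ}
    (hM : ∀ x, Nat.card {x' // σ x x'} ≤ M) : Fintype.card L ≤ 2 * (Fintype.card I * M) := by
  classical
  have h1 : ∀ x, 1 - M / ((Finset.univ.filter fun x' => z x' = z x).card : ℝ)
      ≤ localImpurity z σ x := by
    intro x
    have hpos : 0 < (Finset.univ.filter fun x' => z x' = z x).card :=
      Finset.card_pos.mpr ⟨x, by simp⟩
    have hpos' : (0 : ℝ) < (Finset.univ.filter fun x' => z x' = z x).card := by exact_mod_cast hpos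
    have h2 : (Finset.univ.filter fun x' => z x' = z x).card ≤ M +
        (Finset.univ.filter fun x' => z x' = z x ∧ ¬ σ x x').card := by
      refine le_trans (Finset.card_le_card (t := (Finset.univ.filter fun x' => σ x x') ∪
        (Finset.univ.filter fun x' => z x' = z x ∧ ¬ σ x x')) ?_) ((Finset.card_union_le _ _).trans
          (Nat.add_le_add_right ?_ _))
      · intro y hy
        simp only [Finset.mem_filter, Finset.mem_univ, true_and, Finset.mem_union] at hy ⊢
        tauto
      · rw [← Fintype.card_subtype, ← Nat.card_eq_fintype_card]
        exact hM x
    have h2' : ((Finset.univ.filter fun x' => z x' = z x).card : ℝ) ≤ M +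
        (Finset.univ.filter fun x' => z x' = z x ∧ ¬ σ x x').card := by exact_mod_cast h2
    unfold localImpurity
    rw [sub_le_iff_le_add, ← add_div, le_div_iff₀ hpos', one_mul]
    refine h2'.trans (le_of_eq ?_)
    rw [add_comm]
  have h2 : ∑ x, M / ((Finset.univ.filter fun x' => z x' = z x).card : ℝ) ≤
      Fintype.card I * M := by
    rw [← Finset.sum_fiberwise Finset.univ z]
    calc _ ≤ ∑ i : I, (M : ℝ) := by
          refine Finset.sum_le_sum fun i _ => ?_
          have : ∀ x ∈ Finset.univ.filter (fun x => z x = i),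
              (M : ℝ) / ((Finset.univ.filter fun x' => z x' = z x).card : ℝ)
              = M / ((Finset.univ.filter fun x' => z x' = i).card : ℝ) := by
            intro x hx
            rw [(Finset.mem_filter.mp hx).2]
          rw [Finset.sum_congr rfl this, Finset.sum_const, nsmul_eq_mul]
          rcases (Finset.univ.filter fun x' => z x' = i).eq_empty_or_nonempty with h0 | h0
          · rw [h0]; simp
          · have : ((Finset.univ.filter fun x' => z x' = i).card : ℝ) ≠ 0 := by
              exact_mod_cast h0.card_pos.ne'
            rw [mul_div_cancel₀ _ this]
      _ = _ := by simp
  have h3 : (Fintype.card L : ℝ) - Fintype.card I * M ≤ impurity z σ := by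
    calc _ ≤ ∑ x, (1 - M / ((Finset.univ.filter fun x' => z x' = z x).card : ℝ)) := by
          rw [Finset.sum_sub_distrib]; simp only [Finset.sum_const, Finset.card_univ, nsmul_eq_mul,
            mul_one]; linarith
      _ ≤ _ := Finset.sum_le_sum fun x _ => h1 x
  have h4 : (Fintype.card L : ℝ) ≤ 2 * (Fintype.card I * M) := by
    have : (0 : ℝ) ≤ Fintype.card L := Nat.cast_nonneg _
    linarith
  exact_mod_cast h4

end counting

/-! ### Impurity along a chain -/

section chain

variable {L R I J : Type} [Fintype L] [Fintype R] [Fintype I] [Fintype J]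

open Classical in
/-- A step along a chain in a regular, uniformly distributed bipartite graph of density
`2 ^ (-n)`. -/
lemma Separates.impurity_le [Nonempty R] {G H : L → R → Prop} {z : L → I} {w : R → J} {D : ℝ}
    (hreg : RegularApprox G H z w D) {ρ σ : Setoid L} {τ : Setoid R}
    (hz : ∀ x x', z x = z x' → ρ x x') (hsep : Separates G ρ σ τ) {n : ℕ} {η : ℝ}
    (hdeg : ∀ x, 2 ^ n * (Finset.univ.filter fun y => G x y).card = Fintype.card R)
    (hmix : ∀ (φ : L → ℝ) (ψ : R → ℝ), (∀ x, 0 ≤ φ x ∧ φ x ≤ 1) → (∀ y, 0 ≤ ψ y ∧ ψ y ≤ 1) →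
      2 ^ n * ∑ x, φ x * ∑ y ∈ Finset.univ.filter (fun y => G x y), ψ y ≤
        (∑ x, φ x) * (∑ y, ψ y) + η)
    (hη : 2 ^ n * D + η ≤ Fintype.card L * Fintype.card R / 1024)
    (hτ : 32 * impurity w τ ≤ Fintype.card R) : 32 * impurity z σ ≤ Fintype.card L := by
  rcases isEmpty_or_nonempty L with hL | ⟨⟨x₀⟩⟩
  · simp [impurity]
  have h2n : (0 : ℝ) < 2 ^ n := by positivity
  set Δ := (Finset.univ.filter fun y => G x₀ y).card with hΔd
  have hΔR : (2 : ℝ) ^ n * Δ = Fintype.card R := by exact_mod_cast hdeg x₀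
  have hΔ : 0 < Δ := by
    rcases Nat.eq_zero_or_pos Δ with h | h
    · have := hdeg x₀
      rw [← hΔd, h, mul_zero] at this
      exact absurd this.symm Fintype.card_ne_zero
    · exact h
  refine impurity_le_of_separates (η := η / 2 ^ n) hreg hz hsep hΔ (fun x => ?_) ?_ ?_ hτ
  · exact Nat.eq_of_mul_eq_mul_left (by positivity) ((hdeg x).trans (hdeg x₀).symm)
  · intro φ T hφ hT
    have h1 := hmix φ (fun y => if y ∈ T then 1 else 0) hφ (fun y => by split_ifs <;> norm_num)
    have h2 : ∀ x, ∑ y ∈ Finset.univ.filter (fun y => G x y), (if y ∈ T then (1 : ℝ) else 0)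
        = ((T.filter fun y => G x y).card : ℝ) := by
      intro x
      rw [← Finset.sum_filter, Finset.sum_const, nsmul_eq_mul, mul_one, Finset.filter_filter]
      congr 2
      ext y; simp [and_comm]
    have h3 : ∑ y, (if y ∈ T then (1 : ℝ) else 0) = T.card := by simp
    simp only [h2, h3] at h1
    have hφ0 : 0 ≤ ∑ x, φ x := Finset.sum_nonneg fun x _ => (hφ x).1
    have h4 : (∑ x, φ x) * (32 * T.card) ≤ (∑ x, φ x) * (2 ^ n * Δ) :=
      mul_le_mul_of_nonneg_left (by rw [hΔR]; exact hT) hφ0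
    rw [← mul_le_mul_iff_right₀ h2n]
    have h5 : (2 : ℝ) ^ n * (Δ / 32 * ∑ x, φ x + η / 2 ^ n)
        = (∑ x, φ x) * (2 ^ n * Δ) / 32 + η := by field_simp
    rw [h5]
    linarith
  · rw [← mul_le_mul_iff_right₀ h2n]
    have h5 : (2 : ℝ) ^ n * (D + η / 2 ^ n) = 2 ^ n * D + η := by field_simp
    have h6 : (2 : ℝ) ^ n * (Δ * Fintype.card L / 1024)
        = Fintype.card L * (2 ^ n * Δ) / 1024 := by ring
    rw [h5, h6, hΔR]
    exact hη

open Classical in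
/-- The bound `1 / 32` for the relative impurity is reproduced by each step of the chain, so that
the length of the chain does not matter. -/
lemma SepChain.impurity_le [Nonempty L] [Nonempty R] {G H : L → R → Prop} {z : L → I} {w : R → J}
    {D : ℝ} (hreg : RegularApprox G H z w D) {ρL σ : Setoid L} {ρR τ : Setoid R}
    (hz : ∀ x x', z x = z x' → ρL x x') (hw : ∀ y y', w y = w y' → ρR y y') {n : ℕ} {η : ℝ}
    (hdegL : ∀ x, 2 ^ n * (Finset.univ.filter fun y => G x y).card = Fintype.card R)
    (hdegR : ∀ y, 2 ^ n * (Finset.univ.filter fun x => G x y).card = Fintype.card L)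
    (hmix : ∀ (φ : L → ℝ) (ψ : R → ℝ), (∀ x, 0 ≤ φ x ∧ φ x ≤ 1) → (∀ y, 0 ≤ ψ y ∧ ψ y ≤ 1) →
      2 ^ n * ∑ x, φ x * ∑ y ∈ Finset.univ.filter (fun y => G x y), ψ y ≤
        (∑ x, φ x) * (∑ y, ψ y) + η)
    (hη : 2 ^ n * D + η ≤ Fintype.card L * Fintype.card R / 1024)
    (hchain : SepChain G ρL ρR σ τ) :
    32 * impurity z σ ≤ Fintype.card L ∧ 32 * impurity w τ ≤ Fintype.card R := by
  induction hchain with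
  | base h1 h2 =>
    rw [impurity_eq_zero z _ fun x x' h => h1 (hz x x' h),
      impurity_eq_zero w _ fun y y' h => h2 (hw y y' h)]
    constructor <;> simp
  | left _ _ hs ih => exact ⟨hs.impurity_le hreg hz hdegL hmix hη ih.2, ih.2⟩
  | right _ _ hs ih =>
    refine ⟨ih.1, hs.impurity_le (n := n) (η := η) hreg.swap hw (fun y => by convert hdegR y) ?_
      (by rw [mul_comm (Fintype.card R : ℝ)]; exact hη) ih.1⟩
    intro ψ φ hψ hφ
    have h1 := hmix φ ψ hφ hψ
    rw [mul_comm (∑ x, ψ x)]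
    refine le_trans (le_of_eq ?_) h1
    congr 1
    simp only [Finset.sum_filter, Finset.mul_sum]
    rw [Finset.sum_comm]
    refine Finset.sum_congr rfl fun x _ => Finset.sum_congr rfl fun y _ => ?_
    split_ifs <;> ring

end chain

/-! ### Blow-ups of designs -/

section blowup

variable {A B L R : Type} [Fintype L] [Fintype R]

open Classical in
lemma card_filter_comp [Fintype B] {π : R → B} {q : ℕ}
    (hπ : ∀ b, (Finset.univ.filter fun y => π y = b).card = q) (p : B → Prop) :
    (Finset.univ.filter fun y => p (π y)).card = (Finset.univ.filter p).card * q := by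
  rw [Finset.card_eq_sum_card_fiberwise (f := π) (t := Finset.univ.filter p)
    (fun y hy => by simpa using hy), ← smul_eq_mul, ← Finset.sum_const]
  refine Finset.sum_congr rfl fun b hb => ?_
  rw [← hπ b, Finset.filter_filter]
  congr 1
  refine Finset.filter_congr fun y _ => ?_
  constructor
  · exact fun h => h.2
  · rintro rfl; exact ⟨(Finset.mem_filter.mp hb).2, rfl⟩

omit [Fintype L] in
lemma Separates.comap [Fintype B] {E : A → B → Prop} {ρ σ : Setoid A} {τ : Setoid B} (π : L → A)
    {π' : R → B} {q : ℕ} (hπ' : ∀ b, Nat.card {y // π' y = b} = q) (h : Separates E ρ σ τ) :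
    Separates (fun x y => E (π x) (π' y)) (Setoid.comap π ρ) (Setoid.comap π σ)
      (Setoid.comap π' τ) := by
  classical
  have hq : ∀ b, (Finset.univ.filter fun y => π' y = b).card = q := by
    intro b; rw [← hπ' b, Nat.card_eq_fintype_card, Fintype.card_subtype]
  intro x x' hρ hσ
  have h1 := Nat.mul_le_mul_right q (h (π x) (π x') hρ hσ)
  rw [mul_assoc] at h1
  have h2 : (Finset.univ.filter fun y => E (π x) (π' y)).card ≤
      16 * (Finset.univ.filter fun y => E (π x) (π' y) ∧
        ∀ b', τ (π' y) b' → ¬ E (π x') b').card := by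
    have h3 := card_filter_comp hq (fun b => E (π x) b ∧ ∀ b', τ b b' → ¬ E (π x') b')
    rw [card_filter_comp hq (fun b => E (π x) b)]
    refine h1.trans (le_of_eq ?_)
    congr 1
    convert h3.symm
  have h3 : (Finset.univ.filter fun y => E (π x) (π' y)).card ≤
      16 * (Finset.univ.filter fun y => E (π x) (π' y) ∧
        ∀ y', Setoid.comap π' τ y y' → ¬ E (π x') (π' y')).card :=
    h2.trans (Nat.mul_le_mul_left _ (Finset.card_le_card
      (Finset.monotone_filter_right _ fun y _ hy => ⟨hy.1, fun y' hy' => hy.2 _ hy'⟩)))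
  convert h3

lemma SepChain.comap [Fintype A] [Fintype B] {E : A → B → Prop} {ρA σ : Setoid A}
    {ρB τ : Setoid B} {π : L → A} {π' : R → B} {q q' : ℕ}
    (hπ : ∀ a, Nat.card {x // π x = a} = q) (hπ' : ∀ b, Nat.card {y // π' y = b} = q')
    (h : SepChain E ρA ρB σ τ) :
    SepChain (fun x y => E (π x) (π' y)) (Setoid.comap π ρA) (Setoid.comap π' ρB)
      (Setoid.comap π σ) (Setoid.comap π' τ) := by
  induction h with
  | base h1 h2 => exact SepChain.base (fun _ _ h => h1 h) (fun _ _ h => h2 h)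
  | left _ hle hs ih => exact SepChain.left ih (fun _ _ h => hle h) (hs.comap π hπ')
  | right _ hle hs ih => exact SepChain.right ih (fun _ _ h => hle h) (hs.comap π' hπ)

open Classical in
omit [Fintype L] in
lemma IsDesign.degree_comp {K P : Type} [Fintype A] [Fintype B] {n : ℕ} {θ : ℝ} {κ : A → B → K}
    {ρA : A → P} {ρB : B → P} {β : Setoid B} (hd : IsDesign n θ κ ρA ρB β) {π : L → A}
    {π' : R → B} {q' : ℕ} (hπ' : ∀ b, Nat.card {y // π' y = b} = q') (f : K) (x : L) :
    2 ^ n * (Finset.univ.filter fun y => κ (π x) (π' y) = f).card = Fintype.card R := by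
  have hq' : ∀ b, (Finset.univ.filter fun y => π' y = b).card = q' := by
    intro b; rw [← hπ' b, Nat.card_eq_fintype_card, Fintype.card_subtype]
  have hR : Fintype.card R = Fintype.card B * q' := by
    simpa using card_filter_comp hq' (fun _ => True)
  have h2 : (Finset.univ.filter fun y => κ (π x) (π' y) = f).card = _ :=
    card_filter_comp hq' (fun b => κ (π x) b = f)
  rw [hR, ← hd.degree_left (π x) f, mul_assoc, ← h2]

/-- If a colour class of the blow-up of a design is approximated by a regular partition, then the
partition has at least half as many parts as the design has points on the right. -/
lemma IsDesign.card_le {I J K P : Type} [Fintype A] [Fintype B] [Fintype I] [Fintype J]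
    [Nonempty L] [Nonempty R] {n : ℕ} {θ : ℝ} {κ : A → B → K} {ρA : A → P} {ρB : B → P}
    {β : Setoid B} (hd : IsDesign n θ κ ρA ρB β) {π : L → A} {π' : R → B} {q q' : ℕ}
    (hπ : ∀ a, Nat.card {x // π x = a} = q) (hπ' : ∀ b, Nat.card {y // π' y = b} = q') (f : K)
    {H : L → R → Prop} {z : L → I} {w : R → J} {D : ℝ}
    (hz : ∀ x x', z x = z x' → ρA (π x) = ρA (π x'))
    (hw : ∀ y y', w y = w y' → ρB (π' y) = ρB (π' y'))
    (hreg : RegularApprox (fun x y => κ (π x) (π' y) = f) H z w D)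
    (hD : 2 ^ n * D + n * θ * (Fintype.card L * Fintype.card R) ≤
      Fintype.card L * Fintype.card R / 1024) :
    Fintype.card R ≤ 2 * (Fintype.card J * q') := by
  classical
  have hq : ∀ a, (Finset.univ.filter fun x => π x = a).card = q := by
    intro a; rw [← hπ a, Nat.card_eq_fintype_card, Fintype.card_subtype]
  have hq' : ∀ b, (Finset.univ.filter fun y => π' y = b).card = q' := by
    intro b; rw [← hπ' b, Nat.card_eq_fintype_card, Fintype.card_subtype]
  have hL : Fintype.card L = Fintype.card A * q := by
    simpa using card_filter_comp hq (fun _ => True)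
  have hR : Fintype.card R = Fintype.card B * q' := by
    simpa using card_filter_comp hq' (fun _ => True)
  have hqpos : (0 : ℝ) < q := by
    have : 0 < Fintype.card L := Fintype.card_pos
    rw [hL] at this
    exact_mod_cast Nat.pos_of_mul_pos_left this
  have hqpos' : (0 : ℝ) < q' := by
    have : 0 < Fintype.card R := Fintype.card_pos
    rw [hR] at this
    exact_mod_cast Nat.pos_of_mul_pos_left this
  have hchain : SepChain (fun x y => κ (π x) (π' y) = f) (Setoid.comap π (Setoid.ker ρA))
      (Setoid.comap π' (Setoid.ker ρB)) (Setoid.comap π ⊥) (Setoid.comap π' ⊥) :=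
    SepChain.comap hπ hπ' (SepChain.right (hd.chain f) bot_le (hd.separates_right f))
  have himp := hchain.impurity_le (n := n)
    (η := n * θ * (Fintype.card L * Fintype.card R)) hreg hz hw ?_ ?_ ?_ hD
  · refine card_le_of_impurity_le himp.2 fun y => ?_
    rw [← hπ' (π' y)]
    refine le_of_eq (Nat.card_congr (Equiv.subtypeEquivRight fun y' => ?_))
    exact eq_comm
  · intro x
    convert hd.degree_comp (π := π) hπ' f x
  · intro y
    have h1 : 2 ^ n * (Finset.univ.filter fun a => κ a (π' y) = f).card = Fintype.card A := by
      convert hd.degree_right (π' y) f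
    have h2 : (Finset.univ.filter fun x => κ (π x) (π' y) = f).card = _ :=
      card_filter_comp hq (fun a => κ a (π' y) = f)
    rw [hL, ← h1, mul_assoc, ← h2]
  · intro φ ψ hφ hψ
    let φ' : A → ℝ := fun a => (∑ x ∈ Finset.univ.filter (fun x => π x = a), φ x) / q
    let ψ' : B → ℝ := fun b => (∑ y ∈ Finset.univ.filter (fun y => π' y = b), ψ y) / q'
    have hφ' : ∀ a, 0 ≤ φ' a ∧ φ' a ≤ 1 := by
      intro a
      refine ⟨div_nonneg (Finset.sum_nonneg fun x _ => (hφ x).1) hqpos.le, ?_⟩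
      rw [div_le_one hqpos, ← hq a]
      calc _ ≤ ∑ x ∈ Finset.univ.filter (fun x => π x = a), (1 : ℝ) :=
            Finset.sum_le_sum fun x _ => (hφ x).2
        _ = _ := by simp
    have hψ' : ∀ b, 0 ≤ ψ' b ∧ ψ' b ≤ 1 := by
      intro b
      refine ⟨div_nonneg (Finset.sum_nonneg fun y _ => (hψ y).1) hqpos'.le, ?_⟩
      rw [div_le_one hqpos', ← hq' b]
      calc _ ≤ ∑ y ∈ Finset.univ.filter (fun y => π' y = b), (1 : ℝ) :=
            Finset.sum_le_sum fun y _ => (hψ y).2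
        _ = _ := by simp
    have hsφ : ∑ x, φ x = q * ∑ a, φ' a := by
      rw [← Finset.sum_fiberwise Finset.univ π, ← Finset.sum_div, mul_div_cancel₀ _ hqpos.ne']
    have hsψ : ∑ y, ψ y = q' * ∑ b, ψ' b := by
      rw [← Finset.sum_fiberwise Finset.univ π', ← Finset.sum_div, mul_div_cancel₀ _ hqpos'.ne']
    have hinner : ∀ a, ∑ y ∈ Finset.univ.filter (fun y => κ a (π' y) = f), ψ y
        = q' * ∑ b ∈ Finset.univ.filter (fun b => κ a b = f), ψ' b := by
      intro a
      rw [← Finset.sum_div, mul_div_cancel₀ _ hqpos'.ne',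
        ← Finset.sum_fiberwise_of_maps_to (g := π') (t := Finset.univ.filter (fun b => κ a b = f))
          (fun y hy => by simpa using hy)]
      refine Finset.sum_congr rfl fun b hb => Finset.sum_congr ?_ fun _ _ => rfl
      ext y
      simp only [Finset.mem_filter, Finset.mem_univ, true_and] at hb ⊢
      constructor
      · exact fun h => h.2
      · rintro rfl; exact ⟨hb, rfl⟩
    have houter : ∑ x, φ x * ∑ y ∈ Finset.univ.filter (fun y => κ (π x) (π' y) = f), ψ y
        = q * q' * ∑ a, φ' a * ∑ b ∈ Finset.univ.filter (fun b => κ a b = f), ψ' b := by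
      rw [← Finset.sum_fiberwise Finset.univ π, Finset.mul_sum]
      refine Finset.sum_congr rfl fun a _ => ?_
      have : ∀ x ∈ Finset.univ.filter (fun x => π x = a),
          φ x * ∑ y ∈ Finset.univ.filter (fun y => κ (π x) (π' y) = f), ψ y
          = φ x * (q' * ∑ b ∈ Finset.univ.filter (fun b => κ a b = f), ψ' b) := by
        intro x hx
        rw [(Finset.mem_filter.mp hx).2, hinner]
      rw [Finset.sum_congr rfl this, ← Finset.sum_mul]
      simp only [φ']
      field_simp
    have hm := hd.mixing f φ' ψ' hφ' hψ'
    have hm' : 2 ^ n * ∑ a, φ' a * ∑ b ∈ Finset.univ.filter (fun b => κ a b = f), ψ' b ≤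
      (∑ a, φ' a) * (∑ b, ψ' b) + n * θ * (Fintype.card A * Fintype.card B) := by convert hm
    have h9 := mul_le_mul_of_nonneg_left hm' (mul_pos hqpos hqpos').le
    have h10 : 2 ^ n * ∑ x, φ x * ∑ y ∈ Finset.univ.filter (fun y => κ (π x) (π' y) = f), ψ y ≤
        (∑ x, φ x) * (∑ y, ψ y) + n * θ * (Fintype.card L * Fintype.card R) := by
      rw [houter, hsφ, hsψ, hL, hR]
      push_cast
      calc _ = _ := by ring
        _ ≤ _ := h9
        _ = _ := by ring
    convert h10

end blowup

/-! ### Regular equipartitions -/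

lemma pairDensity_eq {V : Type} (G : SimpleGraph V) (A B : Finset V) :
    pairDensity G A B = (edgeCount G.Adj A B : ℝ) / (A.card * B.card) := by
  classical
  unfold pairDensity edgeCount
  rw [SimpleGraph.edgeDensity_def, SimpleGraph.interedges_def]
  push_cast
  congr!

lemma edgeCount_le {L R : Type} (H : L → R → Prop) (S : Finset L) (T : Finset R) :
    edgeCount H S T ≤ S.card * T.card := by
  classical
  unfold edgeCount
  rw [← Finset.card_product]
  exact Finset.card_filter_le _ _

/-- In a regular pair the number of edges between arbitrary subsets is as expected, up to an error
relative to the whole pair. -/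
lemma IsRegularPair.abs_edgeCount_sub_le {V : Type} {G : SimpleGraph V} {ε : ℝ} {A B : Finset V}
    (h : IsRegularPair G ε A B) {S T : Finset V} (hS : S ⊆ A) (hT : T ⊆ B) :
    |(edgeCount G.Adj S T : ℝ) - pairDensity G A B * (S.card * T.card)| ≤
      ε * (A.card * B.card) := by
  classical
  have hST : (edgeCount G.Adj S T : ℝ) = pairDensity G S T * (S.card * T.card) := by
    rw [pairDensity_eq]
    by_cases h0 : ((S.card : ℝ) * T.card) = 0
    · have h1 : (edgeCount G.Adj S T : ℝ) ≤ S.card * T.card := by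
        exact_mod_cast edgeCount_le G.Adj S T
      have h2 : (0 : ℝ) ≤ edgeCount G.Adj S T := Nat.cast_nonneg _
      rw [h0, mul_zero]; linarith
    · rw [div_mul_cancel₀ _ h0]
  have hd0 : ∀ A B : Finset V, 0 ≤ pairDensity G A B := fun A B => by
    unfold pairDensity; exact_mod_cast SimpleGraph.edgeDensity_nonneg _ _ _
  have hd1 : ∀ A B : Finset V, pairDensity G A B ≤ 1 := fun A B => by
    unfold pairDensity; exact_mod_cast SimpleGraph.edgeDensity_le_one _ _ _
  have hSA : (S.card : ℝ) ≤ A.card := by exact_mod_cast Finset.card_le_card hS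
  have hTB : (T.card : ℝ) ≤ B.card := by exact_mod_cast Finset.card_le_card hT
  have hS0 : (0 : ℝ) ≤ S.card := Nat.cast_nonneg _
  have hT0 : (0 : ℝ) ≤ T.card := Nat.cast_nonneg _
  rw [hST, ← sub_mul, abs_mul, abs_of_nonneg (mul_nonneg hS0 hT0)]
  by_cases hlarge : ε * A.card ≤ S.card ∧ ε * B.card ≤ T.card
  · have h1 := h S hS T hT hlarge.1 hlarge.2
    rw [abs_sub_comm] at h1
    calc _ ≤ ε * (S.card * T.card) := mul_le_mul_of_nonneg_right h1 (mul_nonneg hS0 hT0)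
      _ ≤ _ := mul_le_mul_of_nonneg_left (mul_le_mul hSA hTB hT0 (hS0.trans hSA))
        ((abs_nonneg _).trans h1)
  · have h1 : |pairDensity G S T - pairDensity G A B| ≤ 1 := by
      rw [abs_le]
      constructor <;> linarith [hd0 S T, hd1 S T, hd0 A B, hd1 A B]
    have h2 : (S.card : ℝ) * T.card ≤ ε * (A.card * B.card) := by
      rw [not_and_or, not_le, not_le] at hlarge
      rcases hlarge with hl | hl
      · calc (S.card : ℝ) * T.card ≤ (ε * A.card) * B.card :=
              mul_le_mul hl.le hTB hT0 (hS0.trans hl.le)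
          _ = _ := by ring
      · calc (S.card : ℝ) * T.card ≤ A.card * (ε * B.card) :=
              mul_le_mul hSA hl.le hT0 (hS0.trans hSA)
          _ = _ := by ring
    calc _ ≤ 1 * ((S.card : ℝ) * T.card) := mul_le_mul_of_nonneg_right h1 (mul_nonneg hS0 hT0)
      _ ≤ _ := by rw [one_mul]; exact h2

open Classical in
/-- The errors of `IsRegularPair.abs_edgeCount_sub_le`, together with all pairs of vertices in
irregular pairs of parts, amount to a proportion `O(ε)`, since the parts of an equipartition have at
most twice the average size. -/
lemma IsRegularEquipartition.sum_error_le {V : Type} [Fintype V] [DecidableEq V]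
    {G : SimpleGraph V} {ε : ℝ} {Z : Finpartition (Finset.univ : Finset V)}
    (h : IsRegularEquipartition G ε Z) :
    ∑ A ∈ Z.parts, ∑ B ∈ Z.parts, (if IsRegularPair G ε A B then ε * ((A.card : ℝ) * B.card)
      else (A.card : ℝ) * B.card) ≤ 5 * ε * (Fintype.card V : ℝ) ^ 2 := by
  obtain ⟨heq, hirr⟩ := h
  set n := Fintype.card V
  set k := Z.parts.card
  have hkn : k ≤ n := Z.card_parts_le_card
  have hpart : ∀ A ∈ Z.parts, (k : ℝ) * A.card ≤ 2 * n := by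
    intro A hA
    have h1 := heq.card_part_le_average_add_one hA
    rw [Finset.card_univ] at h1
    have h2 : k * A.card ≤ 2 * n := by
      calc k * A.card ≤ k * (n / k + 1) := Nat.mul_le_mul_left _ h1
        _ = k * (n / k) + k := by ring
        _ ≤ n + n := Nat.add_le_add (Nat.mul_div_le _ _) hkn
        _ = 2 * n := by ring
    exact_mod_cast h2
  have hsum : ∑ A ∈ Z.parts, (A.card : ℝ) = n := by
    have := Z.sum_card_parts
    rw [Finset.card_univ] at this
    exact_mod_cast this
  set Irr := (Z.parts ×ˢ Z.parts).filter fun AB => ¬ IsRegularPair G ε AB.1 AB.2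
  rcases Nat.eq_zero_or_pos k with hk | hk
  · have hempty : Z.parts = ∅ := Finset.card_eq_zero.mp hk
    rw [hempty] at hsum ⊢
    rw [← hsum]; simp
  have hkR : (0 : ℝ) < k := by exact_mod_cast hk
  have hε : 0 ≤ ε := by
    have h1 : (0 : ℝ) ≤ ε * (k : ℝ) ^ 2 := le_trans (Nat.cast_nonneg _) hirr
    exact nonneg_of_mul_nonneg_left h1 (by positivity)
  have hIrr : ∑ p ∈ Irr, ((p.1.card : ℝ) * p.2.card) ≤ 4 * ε * (n : ℝ) ^ 2 := by
    have h1 : ∀ p ∈ Irr, ((p.1.card : ℝ) * p.2.card) ≤ (2 * n / k) * (2 * n / k) := by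
      intro p hp
      have hp' := Finset.mem_product.mp (Finset.mem_filter.mp hp).1
      refine mul_le_mul ?_ ?_ (Nat.cast_nonneg _) (by positivity)
      · rw [le_div_iff₀ hkR, mul_comm]; exact hpart _ hp'.1
      · rw [le_div_iff₀ hkR, mul_comm]; exact hpart _ hp'.2
    calc _ ≤ (Irr.card : ℝ) * ((2 * n / k) * (2 * n / k)) := by
          refine (Finset.sum_le_sum h1).trans ?_
          rw [Finset.sum_const, nsmul_eq_mul]
      _ ≤ (ε * (k : ℝ) ^ 2) * ((2 * n / k) * (2 * n / k)) :=
          mul_le_mul_of_nonneg_right hirr (by positivity)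
      _ = _ := by field_simp; ring
  rw [← Finset.sum_product']
  calc _ ≤ ∑ p ∈ Z.parts ×ˢ Z.parts, (ε * ((p.1.card : ℝ) * p.2.card) +
        if ¬ IsRegularPair G ε p.1 p.2 then (p.1.card : ℝ) * p.2.card else 0) := by
        refine Finset.sum_le_sum fun p _ => ?_
        by_cases hp : IsRegularPair G ε p.1 p.2
        · simp [hp]
        · simp only [hp, if_false, not_false_eq_true, if_true]
          have : 0 ≤ ε * ((p.1.card : ℝ) * p.2.card) := by positivity
          linarith
    _ = ε * (n * n) + ∑ p ∈ Irr, ((p.1.card : ℝ) * p.2.card) := by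
        have h1 : ∑ p ∈ Z.parts ×ˢ Z.parts, ((p.1.card : ℝ) * p.2.card) = n * n := by
          rw [← hsum, Finset.sum_mul_sum, Finset.sum_product]
        rw [Finset.sum_add_distrib, ← Finset.mul_sum, ← Finset.sum_filter, h1]
    _ ≤ ε * (n * n) + 4 * ε * (n : ℝ) ^ 2 := by linarith
    _ = _ := by ring

/-! ### Bipartite graphs -/

/-- The bipartite graph of a relation between two types. -/
def bipartiteGraph {L R : Type} (r : L → R → Prop) : SimpleGraph (L ⊕ R) where
  Adj u v := (∃ x y, r x y ∧ u = Sum.inl x ∧ v = Sum.inr y) ∨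
    (∃ x y, r x y ∧ v = Sum.inl x ∧ u = Sum.inr y)
  symm := ⟨fun _ _ h => h.symm⟩
  loopless := ⟨fun u h => by
    rcases h with ⟨x, y, -, rfl, h⟩ | ⟨x, y, -, rfl, h⟩ <;> cases h⟩

lemma bipartiteGraph_adj {L R : Type} (r : L → R → Prop) (x : L) (y : R) :
    (bipartiteGraph r).Adj (Sum.inl x) (Sum.inr y) ↔ r x y := by
  simp [bipartiteGraph]

open Classical in
lemma ncard_edgeSet_bipartiteGraph {L R : Type} [Fintype L] [Fintype R] (r : L → R → Prop) :
    (bipartiteGraph r).edgeSet.ncard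
      = (Finset.univ.filter fun p : L × R => r p.1 p.2).card := by
  have h1 : (bipartiteGraph r).edgeSet = (fun p : L × R => s(Sum.inl p.1, Sum.inr p.2)) ''
      {p | r p.1 p.2} := by
    ext e
    induction e using Sym2.ind with
    | _ u v =>
      simp only [SimpleGraph.mem_edgeSet, bipartiteGraph, Set.mem_image, Prod.exists,
        Set.mem_ofPred_eq]
      constructor
      · rintro (⟨x, y, h, rfl, rfl⟩ | ⟨x, y, h, rfl, rfl⟩)
        · exact ⟨x, y, h, rfl⟩
        · exact ⟨x, y, h, Sym2.eq_swap⟩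
      · rintro ⟨x, y, h, he⟩
        rcases Sym2.eq_iff.mp he with ⟨rfl, rfl⟩ | ⟨rfl, rfl⟩
        · exact Or.inl ⟨x, y, h, rfl, rfl⟩
        · exact Or.inr ⟨x, y, h, rfl, rfl⟩
  rw [h1, Set.ncard_image_of_injective, Set.ncard_eq_toFinset_card']
  · congr 1
    ext p; simp
  · rintro ⟨x, y⟩ ⟨x', y'⟩ h
    simpa using h

lemma edgeCount_map_inl_inr {L R : Type} (H : SimpleGraph (L ⊕ R)) (S : Finset L) (T : Finset R) :
    edgeCount H.Adj (S.map Function.Embedding.inl) (T.map Function.Embedding.inr)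
      = edgeCount (fun x y => H.Adj (Sum.inl x) (Sum.inr y)) S T := by
  classical
  unfold edgeCount
  symm
  refine Finset.card_nbij (fun p => (Sum.inl p.1, Sum.inr p.2)) ?_ ?_ ?_
  · rintro ⟨x, y⟩ h
    simpa using h
  · rintro ⟨x, y⟩ - ⟨x', y'⟩ - h
    simpa using h
  · rintro ⟨u, v⟩ h
    simp only [Finset.coe_filter, Finset.mem_product, Finset.mem_map, Set.mem_ofPred_eq,
      Function.Embedding.inl_apply, Function.Embedding.inr_apply] at h
    obtain ⟨⟨⟨x, hx, rfl⟩, ⟨y, hy, rfl⟩⟩, h⟩ := h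
    exact ⟨(x, y), by simp [hx, hy, h], rfl⟩

open Classical in
/-- A regular equipartition of a graph close to a bipartite graph, refined by labels of the
vertices, approximates the bipartite graph. -/
lemma IsRegularEquipartition.regularApprox {L R P : Type} [Fintype L] [Fintype R] [Fintype P]
    [DecidableEq (L ⊕ R)] {r : L → R → Prop} {H : SimpleGraph (L ⊕ R)} {ε δ : ℝ}
    (hclose : IsCloseTo δ H (bipartiteGraph r))
    {Z : Finpartition (Finset.univ : Finset (L ⊕ R))} (hZ : IsRegularEquipartition H ε Z)
    (a : L → P) (b : R → P) :
    RegularApprox r (fun x y => H.Adj (Sum.inl x) (Sum.inr y))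
      (fun x => ((⟨Z.part (Sum.inl x), Z.part_mem.mpr (Finset.mem_univ _)⟩ : Z.parts), a x))
      (fun y => ((⟨Z.part (Sum.inr y), Z.part_mem.mpr (Finset.mem_univ _)⟩ : Z.parts), b y))
      (δ * (Finset.univ.filter fun p : L × R => r p.1 p.2).card +
        2 * ((Fintype.card P : ℝ) ^ 2 * (5 * ε * (Fintype.card (L ⊕ R) : ℝ) ^ 2))) := by
  let ℓ : Finset (L ⊕ R) → Finset (L ⊕ R) → ℝ := fun A B =>
    if IsRegularPair H ε A B then ε * ((A.card : ℝ) * B.card) else (A.card : ℝ) * B.card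
  refine ⟨fun i j => ℓ i.1 j.1, ?_, ?_⟩
  · rintro ⟨⟨A, hA⟩, p⟩ ⟨⟨B, hB⟩, p'⟩
    have hsub : ∀ S : Finset L, (∀ x ∈ S, ((⟨Z.part (Sum.inl x), Z.part_mem.mpr
        (Finset.mem_univ _)⟩ : Z.parts), a x) = (⟨A, hA⟩, p)) →
        S.map Function.Embedding.inl ⊆ A := by
      intro S hS u hu
      obtain ⟨x, hx, rfl⟩ := Finset.mem_map.mp hu
      have h1 : Z.part (Sum.inl x) = A := congrArg (fun q => (q.1 : Finset (L ⊕ R))) (hS x hx)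
      rw [← h1]
      exact Z.mem_part_self.mpr (Finset.mem_univ _)
    have hsub' : ∀ T : Finset R, (∀ y ∈ T, ((⟨Z.part (Sum.inr y), Z.part_mem.mpr
        (Finset.mem_univ _)⟩ : Z.parts), b y) = (⟨B, hB⟩, p')) →
        T.map Function.Embedding.inr ⊆ B := by
      intro S hS u hu
      obtain ⟨x, hx, rfl⟩ := Finset.mem_map.mp hu
      have h1 : Z.part (Sum.inr x) = B := congrArg (fun q => (q.1 : Finset (L ⊕ R))) (hS x hx)
      rw [← h1]
      exact Z.mem_part_self.mpr (Finset.mem_univ _)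
    by_cases hreg : IsRegularPair H ε A B
    · refine ⟨pairDensity H A B, fun S T hS hT => ?_⟩
      have h1 := hreg.abs_edgeCount_sub_le (hsub S hS) (hsub' T hT)
      rw [Finset.card_map, Finset.card_map, edgeCount_map_inl_inr] at h1
      simp only [ℓ, hreg, if_true]
      exact h1
    · refine ⟨0, fun S T hS hT => ?_⟩
      simp only [ℓ, hreg, if_false, zero_mul, sub_zero, Nat.abs_cast]
      have h1 : S.card ≤ A.card := by
        rw [← Finset.card_map Function.Embedding.inl]; exact Finset.card_le_card (hsub S hS)
      have h2 : T.card ≤ B.card := by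
        rw [← Finset.card_map Function.Embedding.inr]; exact Finset.card_le_card (hsub' T hT)
      exact_mod_cast (edgeCount_le _ S T).trans (Nat.mul_le_mul h1 h2)
  · refine add_le_add ?_ (mul_le_mul_of_nonneg_left ?_ (by norm_num))
    · unfold IsCloseTo at hclose
      rw [ncard_edgeSet_bipartiteGraph] at hclose
      refine le_trans ?_ hclose
      have h1 : (Finset.univ.filter fun p : L × R =>
          ¬ (r p.1 p.2 ↔ H.Adj (Sum.inl p.1) (Sum.inr p.2))).card
          ≤ (symmDiff (bipartiteGraph r).edgeSet H.edgeSet).ncard := by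
        rw [← Set.ncard_coe_finset]
        refine Set.ncard_le_ncard_of_injOn (fun p : L × R => s(Sum.inl p.1, Sum.inr p.2)) ?_ ?_
          (Set.toFinite _)
        · intro p hp
          simp only [Finset.coe_filter, Finset.mem_univ, true_and, Set.mem_ofPred_eq] at hp
          rw [Set.mem_symmDiff, SimpleGraph.mem_edgeSet, SimpleGraph.mem_edgeSet,
            bipartiteGraph_adj]
          tauto
        · rintro ⟨x, y⟩ - ⟨x', y'⟩ - h
          simpa using h
      exact_mod_cast h1
    · have h1 := hZ.sum_error_le
      have h2 : ∑ i : Z.parts × P, ∑ j : Z.parts × P, ℓ i.1 j.1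
          = (Fintype.card P : ℝ) ^ 2 * ∑ A ∈ Z.parts, ∑ B ∈ Z.parts, ℓ A B := by
        simp only [Fintype.sum_prod_type, Finset.sum_const, Finset.card_univ, nsmul_eq_mul]
        simp only [← Finset.mul_sum]
        rw [← mul_assoc, ← sq]
        congr 1
        rw [← Finset.sum_coe_sort Z.parts]
        refine Finset.sum_congr rfl fun A _ => ?_
        rw [← Finset.sum_coe_sort Z.parts]
      rw [h2]
      exact mul_le_mul_of_nonneg_left (by convert h1) (by positivity)

/-! ### The lower bound -/

lemma IsRegularEquipartition.mono {V : Type} [Fintype V] [DecidableEq V] {G : SimpleGraph V}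
    {ε ε' : ℝ} (hε : ε ≤ ε') {Z : Finpartition (Finset.univ : Finset V)}
    (h : IsRegularEquipartition G ε Z) : IsRegularEquipartition G ε' Z := by
  classical
  have hpair : ∀ A B, IsRegularPair G ε A B → IsRegularPair G ε' A B :=
    fun A B hAB A' hA' B' hB' h1 h2 => (hAB A' hA' B' hB'
      ((mul_le_mul_of_nonneg_right hε (Nat.cast_nonneg _)).trans h1)
      ((mul_le_mul_of_nonneg_right hε (Nat.cast_nonneg _)).trans h2)).trans hε
  refine ⟨h.1, le_trans ?_ (h.2.trans (mul_le_mul_of_nonneg_right hε (by positivity)))⟩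
  have hsub : ((Z.parts ×ˢ Z.parts).filter fun AB => ¬ IsRegularPair G ε' AB.1 AB.2).card ≤
      ((Z.parts ×ˢ Z.parts).filter fun AB => ¬ IsRegularPair G ε AB.1 AB.2).card :=
    Finset.card_le_card (Finset.monotone_filter_right _ fun p _ hp hreg => hp (hpair _ _ hreg))
  convert Nat.cast_le (α := ℝ).mpr hsub

lemma one_le_card_parts {V : Type} [Fintype V] [DecidableEq V] [Nonempty V]
    (Z : Finpartition (Finset.univ : Finset V)) : 1 ≤ Z.parts.card :=
  Finset.card_pos.mpr (Z.parts_nonempty Finset.univ_nonempty.ne_empty)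

/-- A map from `Fin N` with fibres of equal size. -/
lemma exists_map_with_fibres {A : Type} [Fintype A] {N q : ℕ} (h : N = Fintype.card A * q) :
    ∃ π : Fin N → A, ∀ a, Nat.card {x // π x = a} = q := by
  have hcard : Fintype.card (Fin N) = Fintype.card (A × Fin q) := by simp [h]
  let E := Fintype.equivOfCardEq hcard
  refine ⟨fun x => (E x).1, fun a => ?_⟩
  rw [Nat.card_congr (E.subtypeEquiv (q := fun p => p.1 = a) fun x => Iff.rfl),
    Nat.card_congr ⟨fun p => p.1.2, fun j => ⟨(a, j), rfl⟩, ?_, fun _ => rfl⟩, Nat.card_fin]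
  rintro ⟨⟨a', j⟩, rfl⟩
  rfl

open Classical in
/-- The colour classes of the blow-up of a design with `2 ^ s` colours force regular partitions of
tower size. The size `2 ^ (2 * h)` of the coarsest partition of the design must be large for the
mixing property and small compared to `2 ^ (2 * s)` for the regularity `2 ^ (-5 * s)`, so that
`h = s - 5` is used for large `s`. -/
lemma exists_forcing_decomposition (s : ℕ) :
    ∃ N₀ : ℕ, 0 < N₀ ∧ ∀ N : ℕ, 0 < N → N₀ ∣ N →
      ∃ r : Fin (2 ^ s) → Fin N → Fin N → Prop, (∀ x y, ∃! i, r i x y) ∧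
        (∀ i, 2 ^ s * (Finset.univ.filter fun p : Fin N × Fin N => r i p.1 p.2).card = N * N) ∧
        (32 ≤ s → ∀ i, ForcesOrder (bipartiteGraph (r i)) ((1 / 2 ^ s) ^ 5) (1 / 4096)
          (towerNat s)) := by
  obtain ⟨h, h4, hs⟩ : ∃ h, 4 ≤ h ∧ (32 ≤ s → s = h + 5) := by
    by_cases hs : 32 ≤ s
    · exact ⟨s - 5, by omega, fun _ => by omega⟩
    · exact ⟨4, le_rfl, fun h => absurd h hs⟩
  obtain ⟨A, B, K, _, _, _, κ, ρA, ρB, β, a, b, hd, hK, hA, hB, -, hb⟩ := exists_design h h4 s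
  have hK' : Fintype.card K = Fintype.card (Fin (2 ^ s)) := by rw [hK, Fintype.card_fin]
  let e := Fintype.equivOfCardEq hK'
  refine ⟨2 ^ (a + b), by positivity, ?_⟩
  rintro N hN ⟨m, hNm⟩
  have hm : 0 < m := by
    rw [hNm] at hN
    exact Nat.pos_of_mul_pos_left hN
  have : Nonempty (Fin N) := ⟨⟨0, hN⟩⟩
  obtain ⟨π, hπ⟩ := exists_map_with_fibres (A := A) (N := N) (q := 2 ^ b * m)
    (by rw [hA, hNm]; ring)
  obtain ⟨π', hπ'⟩ := exists_map_with_fibres (A := B) (N := N) (q := 2 ^ a * m)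
    (by rw [hB, hNm]; ring)
  have hdens : ∀ i, 2 ^ s * (Finset.univ.filter fun p : Fin N × Fin N =>
      κ (π p.1) (π' p.2) = e.symm i).card = N * N := by
    intro i
    have h1 : ∀ x, 2 ^ s * (Finset.univ.filter fun y => κ (π x) (π' y) = e.symm i).card = N := by
      intro x
      have h2 := hd.degree_comp (π := π) hπ' (e.symm i) x
      rw [Fintype.card_fin] at h2
      exact h2
    rw [Finset.card_filter, Fintype.sum_prod_type, Finset.mul_sum]
    simp only [← Finset.card_filter, h1]
    simp
  refine ⟨fun i x y => κ (π x) (π' y) = e.symm i, ?_, hdens, ?_⟩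
  · intro x y
    exact ⟨e (κ (π x) (π' y)), by simp, fun i hi => by simp only [hi, Equiv.apply_symm_apply]⟩
  · intro hs32 i H hclose Z hZ
    have hreg := hZ.regularApprox hclose (fun x => ρA (π x)) (fun y => ρB (π' y))
    have hN0 : (0 : ℝ) < N := by exact_mod_cast hN
    have hE : (2 : ℝ) ^ s * ((Finset.univ.filter fun p : Fin N × Fin N =>
      κ (π p.1) (π' p.2) = e.symm i).card : ℝ) = N * N := by exact_mod_cast hdens i
    -- The design has `2 ^ b` points on the right, more than a tower of height `s`.
    have hcard := hd.card_le hπ hπ' (e.symm i) (fun x x' hx => (Prod.ext_iff.mp hx).2)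
      (fun y y' hy => (Prod.ext_iff.mp hy).2) hreg ?_
    · rw [Fintype.card_prod, Fintype.card_coe, Fintype.card_fin, Fintype.card_fin] at hcard
      have h1 : 2 ^ b ≤ Z.parts.card * 2 ^ (2 * h + 1) := by
        have h2 : 2 ^ b * (2 ^ a * m) ≤ Z.parts.card * 2 ^ (2 * h + 1) * (2 ^ a * m) := by
          calc 2 ^ b * (2 ^ a * m) = N := by rw [hNm]; ring
            _ ≤ _ := hcard
            _ = _ := by ring
        exact Nat.le_of_mul_le_mul_right h2 (by positivity)
      have h3 : 2 ^ towerNat s * 2 ^ (2 * h + 1) ≤ Z.parts.card * 2 ^ (2 * h + 1) := by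
        refine le_trans ?_ h1
        rw [← pow_add]
        exact Nat.pow_le_pow_right (by norm_num) (by omega)
      exact Nat.lt_two_pow_self.le.trans (Nat.le_of_mul_le_mul_right h3 (by positivity))
    · have hsh := hs hs32
      have h27 : 27 ≤ h := by omega
      have hpow : ((h : ℝ) + 5) / 2 ^ h ≤ 1 / 4096 := by
        have h1 : (h + 5) * 4096 ≤ 2 ^ h := by
          obtain ⟨j, rfl⟩ : ∃ j, h = j + 17 := ⟨h - 17, by omega⟩
          have := Nat.lt_two_pow_self (n := j)
          rw [pow_add]
          omega
        rw [div_le_div_iff₀ (by positivity) (by norm_num)]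
        exact_mod_cast (by omega : (h + 5) * 4096 ≤ 1 * 2 ^ h)
      rw [Fintype.card_sum, Fintype.card_fin, Fintype.card_fin]
      push_cast
      set c : ℝ := ((Finset.univ.filter fun p : Fin N × Fin N =>
        κ (π p.1) (π' p.2) = e.symm i).card : ℝ) with hc
      have h5 : (2 : ℝ) ^ s * (1 / 4096 * c + 2 * (((2 : ℝ) ^ (2 * h)) ^ 2 *
          (5 * (1 / 2 ^ s) ^ 5 * ((N : ℝ) + N) ^ 2))) = (N * N) * (1 / 4096 + 40 / 2 ^ 20) := by
        rw [mul_add]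
        have h6 : (2 : ℝ) ^ s * (1 / 4096 * c) = (N * N) * (1 / 4096) := by
          rw [← hE]; ring
        have h7 : (2 : ℝ) ^ s * (2 * (((2 : ℝ) ^ (2 * h)) ^ 2 *
          (5 * (1 / 2 ^ s) ^ 5 * ((N : ℝ) + N) ^ 2))) = (N * N) * (40 / 2 ^ 20) := by
          rw [hsh, pow_add, pow_mul']
          have : (2 : ℝ) ^ h ≠ 0 := by positivity
          field_simp
          ring
        rw [h6, h7]; ring
      rw [h5]
      have h8 : (s : ℝ) * (1 / 2 ^ h) ≤ 1 / 4096 := by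
        rw [hsh]; push_cast; rw [mul_one_div]; exact hpow
      have h9 := mul_le_mul_of_nonneg_right h8 (mul_pos hN0 hN0).le
      have h10 : 0 < (N : ℝ) * N := mul_pos hN0 hN0
      norm_num at h9 ⊢
      linarith

lemma twr_le_towerNat {x : ℝ} {s : ℕ} (h : x ≤ s) : twr x ≤ towerNat s :=
  towerNat_mono (Nat.floor_le_of_le h)

lemma twr_eq_one {x : ℝ} (h : x < 1) : twr x = 1 := by
  rw [twr, Nat.floor_eq_zero.mpr h, towerNat]

lemma exists_graphDensity_ge {p : ℝ} (hp : p < 1) :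
    ∃ n : ℕ, 0 < n ∧ p ≤ graphDensity (⊤ : SimpleGraph (Fin n)) := by
  obtain ⟨n, hn⟩ := exists_nat_gt (1 / (1 - p))
  have h1p : 0 < 1 - p := by linarith
  have hn0 : (0 : ℝ) < n := lt_trans (by positivity) hn
  refine ⟨n, by exact_mod_cast hn0, ?_⟩
  unfold graphDensity
  have h1 : ((⊤ : SimpleGraph (Fin n)).edgeSet.ncard : ℝ) = n * (n - 1) / 2 := by
    rw [Set.ncard_eq_toFinset_card', ← SimpleGraph.edgeFinset,
      SimpleGraph.card_edgeFinset_top_eq_card_choose_two, Fintype.card_fin, Nat.cast_choose_two]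
  rw [h1, Fintype.card_fin, le_div_iff₀ (by positivity)]
  rw [div_lt_iff₀ h1p] at hn
  nlinarith

theorem mainTheorem5 :
    ∃ δ₀ c : ℝ, 0 < δ₀ ∧ 0 < c ∧
      (∀ p : ℝ, 0 < p → p < 1 →
        ((twr (c * Real.logb 2 (1 / p)) : ℕ) : ℕ∞) ≤ sral (p ^ 5) δ₀ p) ∧
      (∀ (s : ℕ) (p : ℝ), p = 1 / 2 ^ s →
        ∃ N₀ : ℕ, 0 < N₀ ∧ ∀ N : ℕ, 0 < N → N₀ ∣ N →
          ∃ F : Fin (2 ^ s) → SimpleGraph (Fin N ⊕ Fin N),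
            IsEdgeDecomposition (completeBipartiteGraph (Fin N) (Fin N)) F ∧
            ∀ i, bipartiteDensity (F i) = p ∧
              ForcesOrder (F i) (p ^ 5) δ₀ (twr (c * Real.logb 2 (1 / p)))) := by
  classical
  refine ⟨1 / 4096, 1 / 64, by norm_num, by norm_num, ?_, ?_⟩
  · intro p hp hp1
    set l := Real.logb 2 (1 / p) with hl
    refine le_iInf₂ fun S hS => ?_
    rw [Nat.cast_le]
    have hone : (1 : ℝ) ≤ 1 / p ^ 5 := by
      rw [le_div_iff₀ (by positivity), one_mul]
      exact pow_le_one₀ hp.le hp1.le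
    have htop : ∀ (V : Type) [Fintype V] [DecidableEq V],
        (((⊤ : Finpartition (Finset.univ : Finset V)).parts.card : ℕ) : ℝ) ≤ 1 / p ^ 5 := by
      intro V _ _
      refine le_trans ?_ hone
      exact_mod_cast (Finset.card_le_card (Finpartition.parts_top_subset _)).trans
        (Finset.card_singleton _).le
    by_cases hl64 : l < 64
    -- The bound is `1`; a graph on a nonempty set only has to be exhibited.
    · rw [twr_eq_one (by linarith)]
      obtain ⟨n, hn, hdens⟩ := exists_graphDensity_ge hp1
      have : Nonempty (Fin n) := ⟨⟨0, hn⟩⟩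
      obtain ⟨H, -, Z, -, -, hZ⟩ :=
        hS (Fin n) ⊤ hdens ⊤ (Finpartition.top_isEquipartition _) (htop _)
      exact (one_le_card_parts Z).trans hZ
    -- A bipartite graph with density `2 ^ (-s)` between its sides has density `2 ^ (-(s + 1))`.
    · rw [not_lt] at hl64
      have hfl : (64 : ℕ) ≤ ⌊l⌋₊ := Nat.le_floor (by exact_mod_cast hl64)
      obtain ⟨s, hs⟩ : ∃ s, ⌊l⌋₊ = s + 1 := ⟨⌊l⌋₊ - 1, by omega⟩
      have hsl : ((s : ℝ) + 1) ≤ l := by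
        have := Nat.floor_le (show 0 ≤ l by linarith)
        rw [hs] at this; exact_mod_cast this
      have hls : l < s + 2 := by
        have := Nat.lt_floor_add_one l
        rw [hs] at this; push_cast at this; linarith
      have hps : p ≤ 1 / 2 ^ (s + 1) := by
        rw [hl, Real.le_logb_iff_rpow_le (by norm_num) (by positivity)] at hsl
        have h1 : (2 : ℝ) ^ (s + 1) ≤ 1 / p := by exact_mod_cast hsl
        rwa [le_div_comm₀ (by positivity) hp] at h1
      obtain ⟨N₀, hN₀, hdec⟩ := exists_forcing_decomposition s
      obtain ⟨r, -, hE, hforce⟩ := hdec N₀ hN₀ dvd_rfl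
      have i₀ : Fin (2 ^ s) := ⟨0, by positivity⟩
      have hNR : (0 : ℝ) < N₀ := by exact_mod_cast hN₀
      have hdens : p ≤ graphDensity (bipartiteGraph (r i₀)) := by
        refine hps.trans (le_of_eq ?_)
        unfold graphDensity
        have h1 : (2 : ℝ) ^ s * ((Finset.univ.filter fun p : Fin N₀ × Fin N₀ =>
          r i₀ p.1 p.2).card : ℝ) = N₀ * N₀ := by exact_mod_cast hE i₀
        rw [ncard_edgeSet_bipartiteGraph, Fintype.card_sum, Fintype.card_fin]
        push_cast
        rw [div_eq_div_iff (by positivity) (by positivity), pow_succ]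
        linear_combination (-4) * h1
      obtain ⟨H, hH, Z, hZ, -, hZS⟩ := hS _ (bipartiteGraph (r i₀)) hdens ⊤
        (Finpartition.top_isEquipartition _) (htop _)
      have hε : p ^ 5 ≤ (1 / 2 ^ s) ^ 5 := by
        refine pow_le_pow_left₀ hp.le (hps.trans ?_) 5
        exact one_div_le_one_div_of_le (by positivity)
          (pow_le_pow_right₀ (by norm_num) (Nat.le_succ s))
      have h1 := hforce (by omega) i₀ H hH Z (hZ.mono hε)
      refine (twr_le_towerNat (s := s) ?_).trans (h1.trans hZS)
      have : (63 : ℝ) ≤ s := by exact_mod_cast (by omega : 63 ≤ s)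
      linarith
  · rintro s p rfl
    have hlog : Real.logb 2 (1 / (1 / 2 ^ s)) = s := by
      rw [one_div_one_div, Real.logb_pow, Real.logb_self_eq_one (by norm_num), mul_one]
    obtain ⟨N₀, hN₀, hdec⟩ := exists_forcing_decomposition s
    refine ⟨N₀, hN₀, fun N hN hdvd => ?_⟩
    obtain ⟨r, hr, hE, hforce⟩ := hdec N hN hdvd
    have : Nonempty (Fin N) := ⟨⟨0, hN⟩⟩
    have hNR : (0 : ℝ) < N := by exact_mod_cast hN
    refine ⟨fun i => bipartiteGraph (r i), ⟨?_, ?_⟩, fun i => ⟨?_, ?_⟩⟩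
    · rintro i u v (⟨x, y, -, rfl, rfl⟩ | ⟨x, y, -, rfl, rfl⟩) <;> simp
    · rintro (x | y) (x' | y') h
      · simp at h
      · simpa only [bipartiteGraph_adj] using hr x y'
      · simpa only [SimpleGraph.adj_comm _ (Sum.inr y), bipartiteGraph_adj] using hr x' y
      · simp at h
    · have h1 : (2 : ℝ) ^ s * ((Finset.univ.filter fun p : Fin N × Fin N =>
        r i p.1 p.2).card : ℝ) = N * N := by exact_mod_cast hE i
      have h2 : edgeCount (fun x y => (bipartiteGraph (r i)).Adj (Sum.inl x) (Sum.inr y))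
          Finset.univ Finset.univ = (Finset.univ.filter fun p : Fin N × Fin N =>
            r i p.1 p.2).card := by
        unfold edgeCount
        simp only [bipartiteGraph_adj, Finset.univ_product_univ]
      unfold bipartiteDensity
      rw [pairDensity_eq, edgeCount_map_inl_inr, h2, Finset.card_map, Finset.card_map,
        Finset.card_univ, Fintype.card_fin, div_eq_div_iff (by positivity) (by positivity)]
      linear_combination h1
    · intro H hH Z hZ
      rw [hlog]
      by_cases hs : 32 ≤ s
      · refine (twr_le_towerNat (s := s) ?_).trans (hforce hs i H hH Z hZ)
        have : (0 : ℝ) ≤ s := Nat.cast_nonneg s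
        linarith
      · rw [twr_eq_one]
        · exact one_le_card_parts Z
        · have : (s : ℝ) < 32 := by exact_mod_cast (by omega : s < 32)
          linarith
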